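/- **Proposition (equivalence of injectivity and universality for $\mathcal{A}=\mathbb{C}^{m\times m}$).** Let $\mathcal{A}=\mathbb{C}^{m\times m}$ with the operator norm, and let $\mathcal{X}$ be a locally compact Hausdorff space. Let $k:\mathcal{X}\times\mathcal{X}\to\mathcal{A}$ be an $\mathcal{A}$-valued positive definite kernel, i.e. $k(x,y)=k(y,x)^*$ and $\sum_{i,j=1}^n c_i^*k(x_i,x_j)c_j$ is positive for all $n\in\mathbb{N}$, $x_i\in\mathcal{X}$, $c_i\in\mathcal{A}$. Assume that $k$ is a $c_0$-kernel: $k$ is bounded and $\phi(x):=k(\cdot,x)$ belongs to $C_0(\mathcal{X},\mathcal{A})$ for every $x\in\mathcal{X}$, where $C_0(\mathcal{X},\mathcal{A})$ is the space of continuous functions $\mathcal{X}\to\mathcal{A}$ vanishing at infinity, with the sup norm. Let $\mathcal{M}_k$ be the reproducing kernel Hilbert $\mathcal{A}$-module of $k$: the completion of the right $\mathcal{A}$-module $\{\sum_{i=1}^n\phi(x_i)c_i\}$ with the $\mathcal{A}$-valued inner product $\langle\sum_i\phi(x_i)c_i,\sum_j\phi(y_j)d_j\rangle=\sum_{i,j}c_i^*k(x_i,y_j)d_j$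 and the norm $\|u\|=\|\langle u,u\rangle\|^{1/2}$; an element $v\in\mathcal{M}_k$ is regarded as the function $x\mapsto\langle\phi(x),v\rangle$ on $\mathcal{X}$. Let $\mathcal{D}(\mathcal{X},\mathcal{A})$ be the set of countably additive $\mathcal{A}$-valued Borel measures $\mu$ on $\mathcal{X}$ of finite total variation that are regular: for every Borel set $E$ and every $\varepsilon>0$ there are a compact $K\subseteq E$ and an open $G\supseteq E$ with $\|\mu(F)\|\le\varepsilon$ for all Borel $F\subseteq G\setminus K$. (The Borel $\sigma$-algebra may be taken to be the one generated by the open sets or the one generated by the compact sets; the statement holds for either choice.) Then every element of $\mathcal{M}_k$, as a function, belongs to $C_0(\mathcal{X},\mathcal{A})$, and for every $\mu\in\mathcal{D}(\mathcal{X},\mathcal{A})$ the function $$\Phi(\mu):=\int_{\mathcal{X}}\phi(x)\,d\mu(x),\qquad \Phi(\mu)(y)=\int_{\mathcal{X}}k(y,x)\,d\mu(x),$$ belongs to $\mathcal{M}_k$ (the integral being the one that is $\sum_i c_i\mu(E_i)$ on step functions $\sum_i c_i\chi_{E_i}$). Moreover, the kernel mean embedding $\Phi:\mathcal{D}(\mathcal{X},\mathcal{A})\to\mathcal{M}_k$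 is injective if and only if $\mathcal{M}_k$ is dense in $C_0(\mathcal{X},\mathcal{A})$. -/

import Mathlib

open scoped ComplexOrder ZeroAtInfty

noncomputable section

/-- An `A`-valued positive definite kernel on `X`, for a C⋆-algebra `A`. An element of `A` is
positive if it is of the form `d⋆ d`. -/
structure PDKernel (X A : Type*) [CStarAlgebra A] where
  toFun : X → X → A
  star_symm : ∀ x y, toFun x y = star (toFun y x)
  pos : ∀ (n : ℕ) (x : Fin n → X) (c : Fin n → A),
    ∃ d : A, ∑ i, ∑ j, star (c i) * toFun (x i) (x j) * c j = star d * d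

namespace PDKernel

variable {X A : Type*} [CStarAlgebra A] (k : PDKernel X A)

/-- The feature map `φ(x) = k(·, x)`, with values in the functions `X → A`. -/
def phi (x : X) : X → A := fun y => k.toFun y x

/-- The functions `∑ᵢ φ(xᵢ) cᵢ`, as a right `A`-submodule of the functions `X → A`
(a right `A`-module is a module over `Aᵐᵒᵖ`). -/
def preSubmodule : Submodule Aᵐᵒᵖ (X → A) := Submodule.span Aᵐᵒᵖ (Set.range k.phi)

/-- The right `A`-module of the functions `∑ᵢ φ(xᵢ) cᵢ`. It is a type of its own, since its norm
is not the one (and its topology not the pointwise one) of functions. -/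
def PreRKHM : Type _ := k.preSubmodule

instance : AddCommGroup k.PreRKHM := inferInstanceAs (AddCommGroup k.preSubmodule)
instance : Module Aᵐᵒᵖ k.PreRKHM := inferInstanceAs (Module Aᵐᵒᵖ k.preSubmodule)

variable {k}

/-- The function underlying an element of `PreRKHM`. -/
def PreRKHM.eval (u : k.PreRKHM) : X → A := u.1

variable (k)

/-- `φ(x)` as an element of `PreRKHM`. -/
def prePhi (x : X) : k.PreRKHM := ⟨k.phi x, Submodule.subset_span ⟨x, rfl⟩⟩

variable {k}

namespace PreRKHM

@[simp] lemma eval_prePhi (x y : X) : (k.prePhi x).eval y = k.toFun y x := rfl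
@[simp] lemma eval_add (u v : k.PreRKHM) (x : X) : (u + v).eval x = u.eval x + v.eval x := rfl
@[simp] lemma eval_neg (u : k.PreRKHM) (x : X) : (-u).eval x = -u.eval x := rfl
@[simp] lemma eval_zero (x : X) : (0 : k.PreRKHM).eval x = 0 := rfl
@[simp] lemma eval_smul (a : Aᵐᵒᵖ) (u : k.PreRKHM) (x : X) :
    (a • u).eval x = u.eval x * a.unop := rfl

lemma ext {u v : k.PreRKHM} (h : ∀ x, u.eval x = v.eval x) : u = v := Subtype.ext (funext h)

lemma exists_rep (u : k.PreRKHM) : ∃ c : X →₀ Aᵐᵒᵖ, (c.sum fun x a => a • k.phi x) = u.eval :=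
  Finsupp.mem_span_range_iff_exists_finsupp.1 u.2

/-- Coefficients of `u` in some representation `u = ∑ᵢ φ(xᵢ) cᵢ`. -/
def rep (u : k.PreRKHM) : X →₀ Aᵐᵒᵖ := u.exists_rep.choose

lemma eval_eq_sum (u : k.PreRKHM) (x : X) :
    u.eval x = ∑ y ∈ u.rep.support, k.toFun x y * (u.rep y).unop := by
  have h := congrFun u.exists_rep.choose_spec x
  rw [← h, Finsupp.sum, Finset.sum_apply]
  rfl

/-- `⟪∑ᵢ φ(xᵢ) cᵢ, ∑ⱼ φ(yⱼ) dⱼ⟫ = ∑ᵢ ∑ⱼ cᵢ⋆ k(xᵢ, yⱼ) dⱼ`, where the inner sum is the value at `xᵢ`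
of the function on the right. See `inner_eq` for the independence of the representation. -/
instance : Inner A k.PreRKHM where
  inner u v := ∑ x ∈ u.rep.support, star (u.rep x).unop * v.eval x

lemma inner_def (u v : k.PreRKHM) :
    inner A u v = ∑ x ∈ u.rep.support, star (u.rep x).unop * v.eval x := rfl

lemma star_inner (u v : k.PreRKHM) : star (inner A u v) = inner A v u := by
  simp only [inner_def, eval_eq_sum u, eval_eq_sum v, Finset.mul_sum, star_sum, star_mul,
    star_star, ← k.star_symm, mul_assoc]
  exact Finset.sum_comm

lemma inner_add_right (u v w : k.PreRKHM) : inner A u (v + w) = inner A u v + inner A u w := by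
  simp [inner_def, mul_add, Finset.sum_add_distrib]

lemma inner_smul_right (u v : k.PreRKHM) (a : Aᵐᵒᵖ) :
    inner A u (a • v) = inner A u v * a.unop := by
  simp [inner_def, Finset.sum_mul, mul_assoc]

lemma inner_add_left (u v w : k.PreRKHM) : inner A (u + v) w = inner A u w + inner A v w := by
  rw [← star_inner, inner_add_right, star_add, star_inner, star_inner]

lemma inner_smul_left (u v : k.PreRKHM) (a : Aᵐᵒᵖ) :
    inner A (a • u) v = star a.unop * inner A u v := by
  rw [← star_inner, inner_smul_right, star_mul, star_inner]

/-- The reproducing property. -/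
lemma inner_prePhi (x : X) (u : k.PreRKHM) : inner A (k.prePhi x) u = u.eval x := by
  rw [← star_inner, inner_def, eval_eq_sum, star_sum]
  refine Finset.sum_congr rfl fun y _ => ?_
  rw [star_mul, star_star, eval_prePhi, ← k.star_symm]

/-- The inner product does not depend on the representation of the left entry. -/
lemma inner_eq {ι : Type*} (s : Finset ι) (x : ι → X) (c : ι → A) (v : k.PreRKHM) :
    inner A (∑ i ∈ s, MulOpposite.op (c i) • k.prePhi (x i)) v =
      ∑ i ∈ s, star (c i) * v.eval (x i) := by
  classical
  induction s using Finset.induction_on with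
  | empty =>
    have : inner A ((0 : Aᵐᵒᵖ) • (0 : k.PreRKHM)) v = 0 := by rw [inner_smul_left]; simp
    simpa using this
  | insert i s hi ih =>
    rw [Finset.sum_insert hi, Finset.sum_insert hi, inner_add_left, ih, inner_smul_left,
      inner_prePhi]
    rfl

lemma inner_self_pos (u : k.PreRKHM) : ∃ d : A, inner A u u = star d * d := by
  set e := u.rep.support.equivFin.symm
  obtain ⟨d, hd⟩ := k.pos _ (fun i => (e i : X)) (fun i => (u.rep (e i)).unop)
  refine ⟨d, ?_⟩
  rw [← hd, inner_def, ← Finset.sum_coe_sort u.rep.support]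
  refine (Fintype.sum_equiv e _
    (fun x : u.rep.support => star (u.rep x).unop * u.eval x) fun i => ?_).symm
  rw [eval_eq_sum, Finset.mul_sum, ← Finset.sum_coe_sort u.rep.support]
  refine Fintype.sum_equiv e _ (fun y : u.rep.support =>
    star (u.rep (e i)).unop * (k.toFun (e i) y * (u.rep y).unop)) fun j => ?_
  rw [mul_assoc]

/-- The norm `‖u‖ = ‖⟪u, u⟫‖^{1/2}`. -/
instance : Norm k.PreRKHM where
  norm u := √‖inner A u u‖

lemma norm_def (u : k.PreRKHM) : ‖u‖ = √‖inner A u u‖ := rfl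

lemma norm_sq (u : k.PreRKHM) : ‖u‖ ^ 2 = ‖inner A u u‖ := Real.sq_sqrt (norm_nonneg _)

/-- The Cauchy-Schwarz inequality. -/
lemma norm_inner_le (u v : k.PreRKHM) : ‖inner A u v‖ ≤ ‖u‖ * ‖v‖ := by
  let _ := CStarAlgebra.spectralOrder A
  have _ := CStarAlgebra.spectralOrderedRing A
  have nn (w : k.PreRKHM) : (0 : A) ≤ inner A w w := by
    obtain ⟨d, hd⟩ := w.inner_self_pos
    rw [hd]; exact star_mul_self_nonneg d
  set a : A := inner A u v with ha
  have key (t : ℝ) (ht : ‖inner A u u‖ < t) : ‖a‖ ^ 2 ≤ t * ‖inner A v v‖ := by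
    have ht0 : 0 < t := (norm_nonneg _).trans_lt ht
    have h1 := nn (MulOpposite.op a • u + MulOpposite.op (-(t • (1 : A))) • v)
    simp only [inner_add_left, inner_add_right, inner_smul_left, inner_smul_right,
      MulOpposite.unop_op, ← ha, ← star_inner u v, star_neg, star_smul, star_one] at h1
    have h2 : star a * inner A u u * a ≤ t • (star a * a) := by
      refine (CStarAlgebra.star_left_conjugate_le_norm_smul
        (IsSelfAdjoint.of_nonneg (nn u))).trans ?_
      exact smul_le_smul_of_nonneg_right ht.le (star_mul_self_nonneg a)
    have h3 : t • (star a * a) ≤ t • (t • inner A v v) := by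
      rw [← sub_nonneg]
      refine h1.trans ?_
      rw [← sub_nonneg] at h2 ⊢
      convert h2 using 1
      rw [add_mul]
      simp only [mul_neg, neg_mul, smul_mul_assoc, mul_smul_comm, one_mul,
        mul_one, mul_assoc, star_trivial, smul_add, smul_neg, neg_add]
      abel
    have h4 : star a * a ≤ t • inner A v v := (smul_le_smul_iff_of_pos_left ht0).1 h3
    have h5 := CStarAlgebra.norm_le_norm_of_nonneg_of_le (star_mul_self_nonneg a) h4
    rwa [CStarRing.norm_star_mul_self, ← sq, norm_smul, Real.norm_of_nonneg ht0.le] at h5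
  have h : ‖a‖ ^ 2 ≤ ‖inner A u u‖ * ‖inner A v v‖ := by
    have hc : ContinuousWithinAt (fun t : ℝ => t * ‖inner A v v‖)
      (Set.Ioi ‖inner A u u‖) ‖inner A u u‖ := by fun_prop
    exact ge_of_tendsto hc (Filter.eventually_of_mem self_mem_nhdsWithin fun t ht => key t ht)
  rw [← norm_sq, ← norm_sq, ← mul_pow] at h
  exact le_of_sq_le_sq h (mul_nonneg (Real.sqrt_nonneg _) (Real.sqrt_nonneg _))

/-- The normed group structure given by the norm `‖u‖ = ‖⟪u, u⟫‖^{1/2}`. -/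
instance : NormedAddCommGroup k.PreRKHM :=
  AddGroupNorm.toNormedAddCommGroup
    { toFun := fun u => ‖u‖
      map_zero' := by
        have := inner_smul_left (0 : k.PreRKHM) (0 : k.PreRKHM) 0
        rw [zero_smul] at this
        rw [norm_def, this]
        simp
      add_le' := fun u v => by
        refine le_of_sq_le_sq ?_ (add_nonneg (Real.sqrt_nonneg _) (Real.sqrt_nonneg _))
        have h : inner A (u + v) (u + v) =
            inner A u u + inner A u v + (inner A v u + inner A v v) := by
          simp only [inner_add_left, inner_add_right]; abel
        have h1 := norm_inner_le u v
        have h2 := norm_inner_le v u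
        have h3 := norm_add_le (inner A u u + inner A u v) (inner A v u + inner A v v)
        have h4 := norm_add_le (inner A u u) (inner A u v)
        have h5 := norm_add_le (inner A v u) (inner A v v)
        rw [norm_sq, h]
        nlinarith [norm_sq u, norm_sq v]
      neg' := fun u => by
        have h : -u = (-1 : Aᵐᵒᵖ) • u := by simp
        rw [norm_def, norm_def, h, inner_smul_left, inner_smul_right]
        simp
      eq_zero_of_map_eq_zero' := fun u hu => by
        refine ext fun x => ?_
        have h := norm_inner_le (k.prePhi x) u
        rw [hu, mul_zero, inner_prePhi] at h
        simpa using h }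

instance : UniformContinuousConstSMul Aᵐᵒᵖ k.PreRKHM where
  uniformContinuous_const_smul a := by
    refine (AddMonoidHomClass.lipschitz_of_bound (DistribSMul.toAddMonoidHom k.PreRKHM a)
      ‖a.unop‖ fun u => ?_).uniformContinuous
    refine le_of_sq_le_sq ?_ (mul_nonneg (norm_nonneg _) (norm_nonneg _))
    rw [DistribSMul.toAddMonoidHom_apply, norm_sq, inner_smul_left, inner_smul_right, mul_pow,
      norm_sq u, sq]
    refine (norm_mul_le _ _).trans ?_
    rw [norm_star, mul_assoc]
    gcongr
    refine (norm_mul_le _ _).trans (mul_comm _ _).le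

lemma continuous_inner : Continuous fun p : k.PreRKHM × k.PreRKHM => inner A p.1 p.2 := by
  let B : k.PreRKHM →+ k.PreRKHM →+ A := AddMonoidHom.mk' (fun u =>
    AddMonoidHom.mk' (fun v => inner A u v) fun v w => inner_add_right u v w)
    fun u v => AddMonoidHom.ext fun w => inner_add_left u v w
  have hB (u v : k.PreRKHM) : ‖B u v‖ ≤ 1 * ‖u‖ * ‖v‖ := by
    rw [one_mul]; exact norm_inner_le u v
  refine continuous_iff_continuousAt.2 fun p => ?_
  have h0 : Filter.Tendsto (fun q : k.PreRKHM × k.PreRKHM =>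
      ‖q.1 - p.1‖ * ‖q.2‖ + ‖p.1‖ * ‖q.2 - p.2‖) (nhds p) (nhds 0) := by
    have : Continuous (fun q : k.PreRKHM × k.PreRKHM =>
      ‖q.1 - p.1‖ * ‖q.2‖ + ‖p.1‖ * ‖q.2 - p.2‖) := by fun_prop
    simpa using this.tendsto p
  refine tendsto_iff_norm_sub_tendsto_zero.2 (squeeze_zero (fun _ => norm_nonneg _) (fun q => ?_) h0)
  have h : inner A q.1 q.2 - inner A p.1 p.2 = B (q.1 - p.1) q.2 + B p.1 (q.2 - p.2) := by
    simp only [map_sub, AddMonoidHom.sub_apply, sub_add_sub_cancel]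
    rfl
  rw [h]
  refine (norm_add_le _ _).trans (add_le_add ?_ ?_)
  · simpa using hB (q.1 - p.1) q.2
  · simpa using hB p.1 (q.2 - p.2)

end PreRKHM

variable (k)

/-- The reproducing kernel Hilbert `A`-module `M_k`: the completion of the module of the functions
`∑ᵢ φ(xᵢ) cᵢ`. It carries the right `A`-multiplication and the `A`-valued inner product extended
by continuity (instances of `UniformSpace.Completion`). -/
abbrev RKHM : Type _ := UniformSpace.Completion k.PreRKHM

/-- The feature map with values in `M_k`. -/
def feature (x : X) : k.RKHM := (k.prePhi x : k.RKHM)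

variable {k}

namespace RKHM

lemma inner_coe (u v : k.PreRKHM) : inner A (u : k.RKHM) (v : k.RKHM) = inner A u v :=
  (UniformSpace.Completion.isDenseInducing_coe.prodMap
    UniformSpace.Completion.isDenseInducing_coe).extend_eq PreRKHM.continuous_inner (u, v)

lemma continuous_inner : Continuous fun p : k.RKHM × k.RKHM => inner A p.1 p.2 := by
  let B : k.PreRKHM →+ k.PreRKHM →+ A := AddMonoidHom.mk' (fun u =>
    AddMonoidHom.mk' (fun v => inner A u v) fun v w => PreRKHM.inner_add_right u v w)
    fun u v => AddMonoidHom.ext fun w => PreRKHM.inner_add_left u v w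
  have hB : Continuous fun p : k.PreRKHM × k.PreRKHM => B p.1 p.2 := PreRKHM.continuous_inner
  exact (UniformSpace.Completion.isDenseInducing_toCompl k.PreRKHM).extend_Z_bilin
    (UniformSpace.Completion.isDenseInducing_toCompl k.PreRKHM) hB

/-- The function `x ↦ ⟪φ(x), v⟫` on `X` as which an element `v` of `M_k` is regarded. -/
def eval (v : k.RKHM) (x : X) : A := inner A (k.feature x) v

lemma eval_coe (u : k.PreRKHM) (x : X) : RKHM.eval (u : k.RKHM) x = PreRKHM.eval u x := by
  rw [eval, feature, inner_coe, PreRKHM.inner_prePhi]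

/-- An element of `M_k` is determined by its function on `X`. -/
lemma eval_injective : Function.Injective (eval : k.RKHM → X → A) := by
  have hadd (w u v : k.RKHM) : inner A w (u + v) = inner A w u + inner A w v := by
    induction w, u, v using UniformSpace.Completion.induction_on₃ with
    | hp =>
      refine isClosed_eq ?_ ?_
      · exact continuous_inner.comp (by fun_prop :
          Continuous fun p : k.RKHM × k.RKHM × k.RKHM => (p.1, p.2.1 + p.2.2))
      · exact (continuous_inner.comp (by fun_prop :
          Continuous fun p : k.RKHM × k.RKHM × k.RKHM => (p.1, p.2.1))).add
          (continuous_inner.comp (by fun_prop :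
          Continuous fun p : k.RKHM × k.RKHM × k.RKHM => (p.1, p.2.2)))
    | ih w u v =>
      rw [← UniformSpace.Completion.coe_add]
      simp only [inner_coe, PreRKHM.inner_add_right]
  have hpre (u : k.PreRKHM) (v : k.RKHM) : inner A (u : k.RKHM) v =
      ∑ x ∈ u.rep.support, star (u.rep x).unop * v.eval x := by
    induction v using UniformSpace.Completion.induction_on with
    | hp =>
      refine isClosed_eq (continuous_inner.comp (by fun_prop :
        Continuous fun v : k.RKHM => ((u : k.RKHM), v))) ?_
      refine continuous_finsetSum _ fun x _ => continuous_const.mul ?_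
      exact continuous_inner.comp (by fun_prop : Continuous fun v : k.RKHM => (k.feature x, v))
    | ih v => simp only [inner_coe, eval_coe, PreRKHM.inner_def]
  have hnorm (v : k.RKHM) : ‖v‖ ^ 2 = ‖inner A v v‖ := by
    induction v using UniformSpace.Completion.induction_on with
    | hp =>
      exact isClosed_eq (by fun_prop) (continuous_inner.comp (by fun_prop :
        Continuous fun v : k.RKHM => (v, v))).norm
    | ih v => rw [inner_coe, UniformSpace.Completion.norm_coe, PreRKHM.norm_sq]
  intro u v h
  have h1 (w : k.RKHM) : inner A w u = inner A w v := by
    induction w using UniformSpace.Completion.induction_on with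
    | hp =>
      exact isClosed_eq (continuous_inner.comp (by fun_prop : Continuous fun w : k.RKHM => (w, u)))
        (continuous_inner.comp (by fun_prop : Continuous fun w : k.RKHM => (w, v)))
    | ih w => rw [hpre, hpre, h]
  have h2 : inner A (u - v) (u - v) = 0 := by
    have h3 := hadd (u - v) (u - v) v
    rw [sub_add_cancel, h1] at h3
    simpa using h3
  have h4 := hnorm (u - v)
  rw [h2, norm_zero] at h4
  exact sub_eq_zero.1 (norm_eq_zero.1 (pow_eq_zero_iff two_ne_zero |>.1 h4))

end RKHM

variable [TopologicalSpace X]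

/-- A `c₀`-kernel: `k` is bounded and every `φ(x) = k(·, x)` is continuous and vanishes at
infinity. -/
def IsC0 (k : PDKernel X A) : Prop :=
  (∃ C : ℝ, ∀ x y, ‖k.toFun x y‖ ≤ C) ∧ ∀ x, ∃ f : C₀(X, A), ⇑f = k.phi x

end PDKernel

/-- `𝓓(X, A)`: the countably additive `A`-valued measures of finite total variation that are
regular, on the given σ-algebra of `X`. -/
def RegularVectorMeasure (X A : Type*) [TopologicalSpace X] [MeasurableSpace X]
    [CStarAlgebra A] : Type _ :=
  {μ : MeasureTheory.VectorMeasure X A //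
    μ.variation Set.univ < ⊤ ∧
    ∀ E, MeasurableSet E → ∀ ε : ℝ, 0 < ε → ∃ K G : Set X, IsCompact K ∧ IsOpen G ∧ K ⊆ E ∧ E ⊆ G ∧
      ∀ F, MeasurableSet F → F ⊆ G \ K → ‖μ F‖ ≤ ε}

/-- The integral `∫ u(x) dμ(x)` of an `A`-valued function with respect to an `A`-valued measure,
with the values of `u` on the left: on step functions it is `∑ᵢ cᵢ μ(Eᵢ)`. -/
def RegularVectorMeasure.integral {X A : Type*} [TopologicalSpace X] [MeasurableSpace X]
    [CStarAlgebra A] (μ : RegularVectorMeasure X A) (u : X → A) : A :=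
  MeasureTheory.VectorMeasure.integral μ.1 u (ContinuousLinearMap.mul ℝ A)

/-- The kernel mean embedding `∫ φ(x) dμ(x)` as a function on `X`: its value at `y` is
`∫ φ(x)(y) dμ(x) = ∫ k(y, x) dμ(x)`. -/
def PDKernel.meanFun {X A : Type*} [TopologicalSpace X] [MeasurableSpace X] [CStarAlgebra A]
    (k : PDKernel X A) (μ : RegularVectorMeasure X A) (y : X) : A :=
  μ.integral fun x => k.phi x y

end

/-!
Write `T_μ(f) = ∫ f(x)⋆ dμ(x)` for `f ∈ C₀(X, A)` and `μ ∈ 𝓓(X, A)`; this is conjugate linear over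
`A` in `f`. The evaluation of elements of `M_k` on `X` is a bounded `A`-linear map
`ι : M_k → C₀(X, A)`, and the mean embedding is the adjoint of `ι` with respect to this pairing:
`⟪v, Φ(μ)⟫ = T_μ(ι v)` for all `v`. The claim is then the duality between dense range and
injectivity of the adjoint, for which the following is needed.

* `Φ(μ)` exists: since `A = ℂ^{m×m}` carries the faithful functional `τ = re tr`, the real inner
  product `τ⟪u, v⟫` defines a norm equivalent to the one of `M_k`, which is thus a Hilbert space to
  which the Riesz theorem applies (`PDKernel.RealRKHM.exists_inner_eq`). The integral of the
  feature map need not exist in the sense of Bochner, as the feature map is only weakly continuous.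
* `T_μ` determines `μ` (`RegularVectorMeasure.ext_of_adjIntegral_eq`): by regularity, `μ(E)` is
  approximated by the integral of a cutoff function, where the error is estimated by the layer cake
  formula (`MeasureTheory.VectorMeasure.norm_integral_smul_const_le`). So `Φ` is injective if the
  range of `ι` is dense.
* Every bounded real functional `F` on `C₀(X, A)` is `f ↦ τ(T_μ(f))` for some `μ`
  (`exists_regularVectorMeasure_apply_eq`): the total variation of `F` is a positive functional,
  hence, by the Riesz-Markov-Kakutani theorem, integration against a measure `ν`. It turns out that
  `ν` is finite and `|F f| ≤ ∫ ‖f‖ dν`, so that `F` is bounded for the norm of `L²(ν)` and has a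
  density `h ∈ L²(ν)`; take `μ = h ν`. If the range of `ι` is not dense, some `F ≠ 0` annihilates it
  by the Hahn-Banach theorem, and then `Φ(μ) = 0` although `μ ≠ 0`.

The argument is carried out for finite dimensional C⋆-algebras `A` with such a functional `τ`, given
by a linear bijection `e` from `A` to an inner product space with `⟪e a, e b⟫ = τ(a⋆ b)`, and for
any σ-algebra between the one generated by the compact sets and the Borel one.
-/

open MeasureTheory Set Filter Topology
open scoped CompactlySupported NNReal ENNReal

/-! ### Measurability of functions vanishing at infinity -/

section Measurability

variable {X E : Type*} [TopologicalSpace X] [NormedAddCommGroup E]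

lemma ZeroAtInftyContinuousMap.isCompact_preimage (f : C₀(X, E)) {s : Set E}
    (hs : IsClosed s) (h0 : (0 : E) ∉ s) : IsCompact (f ⁻¹' s) := by
  have h : f ⁻¹' sᶜ ∈ cocompact X := f.zero_at_infty' (hs.isOpen_compl.mem_nhds h0)
  obtain ⟨K, hK, hKs⟩ := mem_cocompact.1 h
  refine hK.of_isClosed_subset (hs.preimage f.continuous) fun x hx => ?_
  by_contra hxK
  exact hKs hxK hx

/-- It suffices that compact sets are measurable: preimages of closed sets that miss `0` are
compact. -/
lemma ZeroAtInftyContinuousMap.stronglyMeasurable [MeasurableSpace X]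
    (hK : ∀ K : Set X, IsCompact K → MeasurableSet K) [SecondCountableTopology E]
    (f : C₀(X, E)) : StronglyMeasurable f := by
  borelize E
  refine Measurable.stronglyMeasurable (measurable_of_isOpen fun U hU => ?_)
  by_cases h0 : (0 : E) ∈ U
  · rw [← MeasurableSet.compl_iff, ← preimage_compl]
    exact hK _ (f.isCompact_preimage hU.isClosed_compl (by simpa using h0))
  · obtain ⟨F, hF, hFU, hF', -⟩ := hU.exists_iUnion_isClosed
    rw [← hF', preimage_iUnion]
    exact MeasurableSet.iUnion fun n =>
      hK _ (f.isCompact_preimage (hF n) fun h => h0 (hFU n h))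

end Measurability

/-! ### Integrals of real functions against vector measures -/

section LayerCake

variable {X E F G : Type*} [MeasurableSpace X] [NormedAddCommGroup E] [NormedSpace ℝ E]
  [NormedAddCommGroup F] [NormedSpace ℝ F] [NormedAddCommGroup G] [NormedSpace ℝ G]
  [CompleteSpace G]

/-- The layer cake argument: if `0 ≤ u ≤ 1`, then `∫ u dμ` is a limit of averages of values of `μ`
on superlevel sets of `u`, hence it is bounded by a common bound of these values. -/
lemma MeasureTheory.VectorMeasure.norm_integral_smul_const_le (μ : VectorMeasure X F)
    [IsFiniteMeasure μ.variation] (B : E →L[ℝ] F →L[ℝ] G) (c : E) {S : Set X} {ε : ℝ}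
    (hS : ∀ s, MeasurableSet s → s ⊆ S → ‖B c (μ s)‖ ≤ ε) {u : X → ℝ} (hu : Measurable u)
    (h0 : ∀ x, 0 ≤ u x) (h1 : ∀ x, u x ≤ 1) (hsupp : ∀ x, x ∉ S → u x = 0) :
    ‖μ.integral (fun x => u x • c) B‖ ≤ ε := by
  -- The average of the indicator functions of `s n i`, `i < n`, is `⌊n u⌋ / n`.
  set s : ℕ → ℕ → Set X := fun n i => {x | i < ⌊u x * n⌋₊} with hs_def
  have hs (n i : ℕ) : MeasurableSet (s n i) :=
    measurableSet_lt measurable_const (Nat.measurable_floor.comp (hu.mul_const _))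
  have hsS (n i : ℕ) : s n i ⊆ S := by
    intro x hx
    by_contra hxS
    simp [hs_def, hsupp x hxS] at hx
  have hfl (n : ℕ) (x : X) : ⌊u x * n⌋₊ ≤ n :=
    Nat.floor_le_of_le (mul_le_of_le_one_left (Nat.cast_nonneg n) (h1 x))
  have hsum (n : ℕ) (x : X) : ∑ i ∈ Finset.range n, (s n i).indicator (fun _ => c) x =
      (⌊u x * n⌋₊ : ℝ) • c := by
    have : ∀ i, (s n i).indicator (fun _ => c) x = if i < ⌊u x * n⌋₊ then c else 0 := fun i => by
      simp [indicator_apply, hs_def]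
    simp only [this]
    rw [← Finset.sum_filter, Finset.sum_const]
    have : (Finset.range n).filter (fun i => i < ⌊u x * n⌋₊) = Finset.range ⌊u x * n⌋₊ := by
      ext i
      have := hfl n x
      simp only [Finset.mem_filter, Finset.mem_range]
      omega
    rw [this, Finset.card_range, Nat.cast_smul_eq_nsmul]
  have hmeas (n : ℕ) (i : ℕ) : StronglyMeasurable ((s n i).indicator fun _ => c) :=
    stronglyMeasurable_const.indicator (hs n i)
  set v : ℕ → X → E := fun n x =>
    (n : ℝ)⁻¹ • ∑ i ∈ Finset.range n, (s n i).indicator (fun _ => c) x with hv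
  have hvm (n : ℕ) : StronglyMeasurable (v n) :=
    (Finset.stronglyMeasurable_fun_sum _ fun i _ => hmeas n i).const_smul _
  have hvle (n : ℕ) (x : X) : ‖v n x‖ ≤ ‖c‖ := by
    simp only [hv, hsum, smul_smul, norm_smul]
    refine mul_le_of_le_one_left (norm_nonneg _) ?_
    rw [Real.norm_of_nonneg (by positivity), inv_mul_eq_div]
    exact div_le_one_of_le₀ (by exact_mod_cast hfl n x) (Nat.cast_nonneg n)
  have hlim (x : X) : Tendsto (fun n => v n x) atTop (𝓝 (u x • c)) := by
    have h := (tendsto_nat_floor_mul_div_atTop (h0 x)).comp tendsto_natCast_atTop_atTop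
    refine (h.smul_const c).congr fun n => ?_
    simp only [hv, hsum, smul_smul, Function.comp]
    rw [div_eq_inv_mul]
  have hint (n : ℕ) : ‖μ.integral (v n) B‖ ≤ ε := by
    have hε : 0 ≤ ε := (norm_nonneg _).trans (hS ∅ MeasurableSet.empty (empty_subset _))
    rw [hv]
    rw [VectorMeasure.integral_fun_smul, VectorMeasure.integral_finsetSum]
    · simp only [VectorMeasure.integral_indicator_const c (hs _ _)]
      rw [norm_smul, norm_inv, Real.norm_of_nonneg (Nat.cast_nonneg n)]
      have h2 := norm_sum_le_of_le (Finset.range n) fun i _ => hS _ (hs n i) (hsS n i)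
      rw [Finset.sum_const, Finset.card_range, nsmul_eq_mul] at h2
      rcases Nat.eq_zero_or_pos n with rfl | hn
      · simpa using hε
      · rw [inv_mul_le_iff₀ (by exact_mod_cast hn)]
        exact h2
    · intro i _
      exact (integrable_const c).indicator (hs n i)
  refine le_of_tendsto (VectorMeasure.tendsto_integral_filter_of_norm_le_const (l := atTop)
    (Eventually.of_forall fun n => (hvm n).aestronglyMeasurable)
    ⟨‖c‖, Eventually.of_forall fun n => Eventually.of_forall (hvle n)⟩
    (Eventually.of_forall hlim)).norm (Eventually.of_forall hint)

end LayerCake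

/-! ### Regular vector measures are determined by their integrals -/

namespace RegularVectorMeasure

variable {X A : Type*} [TopologicalSpace X] [MeasurableSpace X] [CStarAlgebra A]

instance (μ : RegularVectorMeasure X A) : IsFiniteMeasure μ.1.variation := ⟨μ.2.1⟩

/-- The measure of `E` is approximated by the integral of a cutoff function `g` with
`1_K ≤ g ≤ 1_G`: the positive and negative parts of `1_E - g` are supported in `G \ K`. -/
lemma norm_integral_sub_le (hK : ∀ K : Set X, IsCompact K → MeasurableSet K)
    (μ : RegularVectorMeasure X A) {E K G : Set X} (hE : MeasurableSet E) {ε : ℝ}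
    (hKE : K ⊆ E) (hEG : E ⊆ G)
    (h : ∀ F, MeasurableSet F → F ⊆ G \ K → ‖μ.1 F‖ ≤ ε) (g : C₀(X, ℝ))
    (h01 : ∀ x, g x ∈ Icc (0 : ℝ) 1) (hg1 : ∀ x ∈ K, g x = 1) (hg0 : ∀ x ∉ G, g x = 0) :
    ‖μ.1 E - μ.integral fun x => g x • (1 : A)‖ ≤ 2 * ε := by
  set B := ContinuousLinearMap.mul ℝ A
  have hgm : Measurable g := (g.stronglyMeasurable hK).measurable
  have hS (s : Set X) (hs : MeasurableSet s) (hsS : s ⊆ G \ K) : ‖B 1 (μ.1 s)‖ ≤ ε := by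
    simpa [B] using h s hs hsS
  have hint {f : X → ℝ} (hf : Measurable f) (h0 : ∀ x, 0 ≤ f x) (h1 : ∀ x, f x ≤ 1) :
      μ.1.Integrable fun x => f x • (1 : A) :=
    Integrable.smul_const (Integrable.of_bound hf.aestronglyMeasurable 1 (Eventually.of_forall
      fun x => by rw [Real.norm_of_nonneg (h0 x)]; exact h1 x)) _
  have key {T : Set X} (hT : MeasurableSet T) {f : X → ℝ} (hf : Measurable f)
      (h0 : ∀ x, 0 ≤ f x) (h1 : ∀ x, f x ≤ 1) (hsupp : ∀ x ∈ T, x ∉ G \ K → f x = 0) :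
      ‖μ.1.integral (fun x => T.indicator f x • (1 : A)) B‖ ≤ ε := by
    refine μ.1.norm_integral_smul_const_le B 1 hS (hf.indicator hT) (fun x => ?_) (fun x => ?_)
      fun x hx => ?_
    · exact indicator_nonneg (fun x _ => h0 x) x
    · exact indicator_le' (fun x _ => h1 x) (fun _ _ => zero_le_one) x
    · by_cases hxT : x ∈ T
      · rw [indicator_of_mem hxT, hsupp x hxT hx]
      · exact indicator_of_notMem hxT _
  have hm1 : Measurable fun x => 1 - g x := measurable_const.sub hgm
  have e1 := key hE hm1 (fun x => by linarith [(h01 x).2]) (fun x => by linarith [(h01 x).1])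
    fun x hx hx' => by
      have hxK : x ∈ K := by
        by_contra hxK
        exact hx' ⟨hEG hx, hxK⟩
      rw [hg1 x hxK, sub_self]
  have e2 := key hE.compl hgm (fun x => (h01 x).1) (fun x => (h01 x).2) fun x hx hx' => by
      refine hg0 x fun hxG => hx' ⟨hxG, fun hxK => hx (hKE hxK)⟩
  have h1E : μ.1 E = μ.1.integral (fun x => E.indicator (fun _ => (1 : A)) x) B := by
    rw [VectorMeasure.integral_indicator_const 1 hE]
    simp [B]
  have e3 : μ.1 E - μ.integral (fun x => g x • (1 : A)) =
      μ.1.integral (fun x => E.indicator (fun x => 1 - g x) x • (1 : A)) B -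
      μ.1.integral (fun x => Eᶜ.indicator g x • (1 : A)) B := by
    rw [h1E, RegularVectorMeasure.integral, ← VectorMeasure.integral_fun_sub,
      ← VectorMeasure.integral_fun_sub]
    · congr 1
      ext x
      by_cases hx : x ∈ E <;> simp [hx, sub_smul]
    · exact hint (hm1.indicator hE) (indicator_nonneg fun x _ => by linarith [(h01 x).2])
        (indicator_le' (fun x _ => by linarith [(h01 x).1]) (fun _ _ => zero_le_one))
    · exact hint (hgm.indicator hE.compl) (indicator_nonneg fun x _ => (h01 x).1)
        (indicator_le' (fun x _ => (h01 x).2) (fun _ _ => zero_le_one))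
    · exact (integrable_const _).indicator hE
    · exact hint hgm (fun x => (h01 x).1) (fun x => (h01 x).2)
  rw [e3, two_mul]
  exact (norm_sub_le _ _).trans (add_le_add e1 e2)

/-- A regular vector measure is determined by the integrals of functions vanishing at infinity. -/
lemma ext_of_integral_eq [T2Space X] [LocallyCompactSpace X]
    (hK : ∀ K : Set X, IsCompact K → MeasurableSet K) {μ ν : RegularVectorMeasure X A}
    (h : ∀ g : C₀(X, ℝ), (μ.integral fun x => g x • (1 : A)) = ν.integral fun x => g x • (1 : A)) :
    μ = ν := by
  refine Subtype.ext (VectorMeasure.ext fun E hE => ?_)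
  rw [← sub_eq_zero, ← norm_le_zero_iff]
  refine le_of_forall_pos_le_add fun ε hε => ?_
  obtain ⟨K₁, G₁, hK₁, hG₁, hKE₁, hEG₁, h₁⟩ := μ.2.2 E hE (ε / 4) (by positivity)
  obtain ⟨K₂, G₂, hK₂, hG₂, hKE₂, hEG₂, h₂⟩ := ν.2.2 E hE (ε / 4) (by positivity)
  obtain ⟨g, hg1, hg0, hgc, hg⟩ := exists_continuous_one_zero_of_isCompact (hK₁.union hK₂)
    (hG₁.inter hG₂).isClosed_compl (disjoint_compl_right_iff_subset.2
      ((union_subset hKE₁ hKE₂).trans (subset_inter hEG₁ hEG₂)))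
  let g' : C₀(X, ℝ) := ⟨g, hgc.is_zero_at_infty⟩
  have a₁ := norm_integral_sub_le hK μ hE (union_subset hKE₁ hKE₂) (subset_inter hEG₁ hEG₂)
    (fun F hF hF' => h₁ F hF (hF'.trans (sdiff_subset_sdiff inter_subset_left subset_union_left)))
    g' hg (fun x hx => hg1 hx) (fun x hx => hg0 hx)
  have a₂ := norm_integral_sub_le hK ν hE (union_subset hKE₁ hKE₂) (subset_inter hEG₁ hEG₂)
    (fun F hF hF' => h₂ F hF (hF'.trans (sdiff_subset_sdiff inter_subset_right subset_union_right)))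
    g' hg (fun x hx => hg1 hx) (fun x hx => hg0 hx)
  rw [h g'] at a₁
  have := norm_sub_le_norm_sub_add_norm_sub (μ.1 E) (ν.integral fun x => g' x • (1 : A)) (ν.1 E)
  rw [norm_sub_rev (ν.integral _)] at this
  linarith

end RegularVectorMeasure

/-! ### The total variation of a functional on functions vanishing at infinity -/

section DualVariation

variable {X E : Type*} [TopologicalSpace X] [NormedAddCommGroup E]

namespace ZeroAtInftyContinuousMap

lemma norm_apply_le (f : C₀(X, E)) (x : X) : ‖f x‖ ≤ ‖f‖ :=
  f.toBCF.norm_coe_le_norm x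

lemma norm_le_of_forall {f : C₀(X, E)} {C : ℝ} (hC : 0 ≤ C) (h : ∀ x, ‖f x‖ ≤ C) : ‖f‖ ≤ C :=
  (BoundedContinuousFunction.norm_le (f := f.toBCF) hC).2 h

/-- A continuous function dominated by one that vanishes at infinity vanishes at infinity. -/
def ofNormLe (f : X → E) (hf : Continuous f) (g : C₀(X, E)) (h : ∀ x, ‖f x‖ ≤ ‖g x‖) :
    C₀(X, E) where
  toFun := f
  continuous_toFun := hf
  zero_at_infty' :=
    squeeze_zero_norm h (tendsto_zero_iff_norm_tendsto_zero.1 g.zero_at_infty')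

variable [NormedSpace ℝ E]

/-- The value at `f ≥ 0` of the total variation of a functional `F`, that is, the supremum of `F`
over the functions bounded by `f` in norm. -/
noncomputable def dualVariation (F : StrongDual ℝ C₀(X, E)) (f : C_c(X, ℝ≥0)) : ℝ :=
  ⨆ g : {g : C₀(X, E) // ∀ x, ‖g x‖ ≤ f x}, F g

variable (F : StrongDual ℝ C₀(X, E)) (f f₁ f₂ : C_c(X, ℝ≥0))

instance : Nonempty {g : C₀(X, E) // ∀ x, ‖g x‖ ≤ f x} := ⟨⟨0, fun x => by simp⟩⟩

lemma apply_le_of_forall_norm_le {C : ℝ} (hC : 0 ≤ C) {g : C₀(X, E)} (h : ∀ x, ‖g x‖ ≤ C) :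
    F g ≤ ‖F‖ * C :=
  (le_abs_self _).trans ((F.le_opNorm g).trans
    (mul_le_mul_of_nonneg_left (norm_le_of_forall hC h) (norm_nonneg _)))

lemma bddAbove_dualVariation :
    BddAbove (range fun g : {g : C₀(X, E) // ∀ x, ‖g x‖ ≤ f x} => F g) := by
  obtain ⟨C, hC⟩ := f.toReal.hasCompactSupport.exists_bound_of_continuous f.toReal.continuous
  have hC' (x : X) : (f x : ℝ) ≤ max C 0 := by
    refine le_max_of_le_left ((le_abs_self _).trans ?_)
    simpa using hC x
  refine ⟨‖F‖ * max C 0, ?_⟩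
  rintro _ ⟨⟨g, hg⟩, rfl⟩
  exact apply_le_of_forall_norm_le F (le_max_right _ _) fun x => (hg x).trans (hC' x)

variable {F f} in
lemma le_dualVariation {g : C₀(X, E)} (h : ∀ x, ‖g x‖ ≤ f x) : F g ≤ dualVariation F f :=
  le_ciSup (bddAbove_dualVariation F f) ⟨g, h⟩

lemma dualVariation_nonneg : 0 ≤ dualVariation F f := by
  simpa using le_dualVariation (F := F) (f := f) (g := 0) fun x => by simp

/-- For the inequality `≤`, a function `g` with `‖g‖ ≤ f₁ + f₂` is split into the functions
`fᵢ / (f₁ + f₂) • g`. -/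
lemma dualVariation_add :
    dualVariation F (f₁ + f₂) = dualVariation F f₁ + dualVariation F f₂ := by
  refine le_antisymm (ciSup_le fun ⟨g, hg⟩ => ?_) (ciSup_add_ciSup_le fun ⟨g₁, h₁⟩ ⟨g₂, h₂⟩ => ?_)
  · let w : X → ℝ := fun x => f₁ x / (f₁ x + f₂ x)
    have hw0 (x : X) : 0 ≤ w x := by positivity
    have hw1 (x : X) : w x ≤ 1 := div_le_one_of_le₀ (by simp) (by positivity)
    have hg' (x : X) : ‖g x‖ ≤ f₁ x + f₂ x := by simpa using hg x
    have hle (x : X) : ‖w x • g x‖ ≤ f₁ x := by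
      rw [norm_smul, Real.norm_of_nonneg (hw0 x)]
      refine (mul_le_mul_of_nonneg_left (hg' x) (hw0 x)).trans ?_
      by_cases hx : (f₁ x + f₂ x : ℝ) = 0
      · simp [hx]
      · exact (div_mul_cancel₀ _ hx).le
    have hc : Continuous fun x => w x • g x := by
      refine continuous_iff_continuousAt.2 fun x => ?_
      by_cases hx : (f₁ x + f₂ x : ℝ) = 0
      · have h1 : (f₁ x : ℝ) = 0 := le_antisymm (hx ▸ by simp) (by positivity)
        have h0 : w x • g x = 0 := norm_le_zero_iff.1 (h1 ▸ hle x)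
        rw [ContinuousAt, h0]
        refine squeeze_zero_norm hle ?_
        have : Continuous fun x => (f₁ x : ℝ) := by fun_prop
        exact h1 ▸ this.tendsto x
      · refine ContinuousAt.smul (ContinuousAt.div ?_ ?_ hx) g.continuous.continuousAt
        · fun_prop
        · fun_prop
    let g₁ : C₀(X, E) := ofNormLe _ hc g fun x => by
      rw [norm_smul, Real.norm_of_nonneg (hw0 x)]
      exact mul_le_of_le_one_left (norm_nonneg _) (hw1 x)
    have hg₂ (x : X) : ‖(g - g₁) x‖ ≤ f₂ x := by
      have h1 : (g - g₁) x = (1 - w x) • g x := by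
        simp only [sub_smul, one_smul]
        rfl
      rw [h1, norm_smul, Real.norm_of_nonneg (sub_nonneg.2 (hw1 x))]
      by_cases hx : (f₁ x + f₂ x : ℝ) = 0
      · rw [le_antisymm ((hg' x).trans hx.le) (norm_nonneg _)]
        simp
      · refine (mul_le_mul_of_nonneg_left (hg' x) (sub_nonneg.2 (hw1 x))).trans (le_of_eq ?_)
        simp only [w]
        field_simp
        ring
    have h : F g = F g₁ + F (g - g₁) := by rw [← map_add, add_sub_cancel]
    simp only [h]
    exact add_le_add (le_dualVariation hle) (le_dualVariation hg₂)
  · rw [← map_add]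
    exact le_dualVariation fun x =>
      (norm_add_le _ _).trans (by simpa using add_le_add (h₁ x) (h₂ x))

lemma mul_dualVariation_le (c : ℝ≥0) : c * dualVariation F f ≤ dualVariation F (c • f) := by
  rw [dualVariation, Real.mul_iSup_of_nonneg c.coe_nonneg]
  refine ciSup_le fun ⟨g, hg⟩ => ?_
  have h : (c : ℝ) * F g = F ((c : ℝ) • g) := by simp
  rw [h]
  refine le_dualVariation fun x => ?_
  rw [smul_apply, norm_smul, Real.norm_of_nonneg c.coe_nonneg]
  simpa using mul_le_mul_of_nonneg_left (hg x) c.coe_nonneg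

lemma dualVariation_smul (c : ℝ≥0) : dualVariation F (c • f) = c * dualVariation F f := by
  refine le_antisymm ?_ (mul_dualVariation_le F f c)
  rcases eq_or_ne c 0 with rfl | hc
  · have h := dualVariation_add F 0 0
    rw [zero_smul, NNReal.coe_zero, zero_mul]
    rw [add_zero] at h
    linarith
  · have h := mul_dualVariation_le F (c • f) c⁻¹
    rw [smul_smul, inv_mul_cancel₀ hc, one_smul, NNReal.coe_inv, inv_mul_le_iff₀] at h
    · exact h
    · exact_mod_cast pos_iff_ne_zero.2 hc

/-- The total variation of a functional, as a positive functional. -/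
noncomputable def dualVariationLinear : C_c(X, ℝ≥0) →ₗ[ℝ≥0] ℝ≥0 where
  toFun f := ⟨dualVariation F f, dualVariation_nonneg F f⟩
  map_add' f₁ f₂ := NNReal.eq (dualVariation_add F f₁ f₂)
  map_smul' c f := NNReal.eq (dualVariation_smul F f c)

variable [T2Space X] [LocallyCompactSpace X]

section Borel

variable {bX : MeasurableSpace X} [BorelSpace X]

instance isFiniteMeasure_rieszMeasure_dualVariationLinear :
    IsFiniteMeasure (NNRealRMK.rieszMeasure (dualVariationLinear F)) := by
  refine ⟨lt_of_le_of_lt (b := ENNReal.ofReal ‖F‖) ?_ ENNReal.ofReal_lt_top⟩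
  rw [isOpen_univ.measure_eq_iSup_isCompact]
  refine iSup₂_le fun K _ => iSup_le fun hK => ?_
  obtain ⟨u, hu1, -, huc, hu⟩ := exists_continuous_one_zero_of_isCompact hK isClosed_empty
    (disjoint_empty K)
  let u' : C_c(X, ℝ≥0) := (⟨u, huc⟩ : C_c(X, ℝ)).nnrealPart
  have h1 : NNRealRMK.rieszMeasure (dualVariationLinear F) K ≤
      ∫⁻ x, u' x ∂NNRealRMK.rieszMeasure (dualVariationLinear F) := by
    rw [← lintegral_indicator_one hK.measurableSet]
    refine lintegral_mono fun x => ?_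
    by_cases hx : x ∈ K
    · have : u' x = 1 := by
        have := hu1 hx
        simp only [u', CompactlySupportedContinuousMap.nnrealPart_apply]
        simpa using this
      simp [hx, this]
    · simp [hx]
  refine h1.trans ?_
  rw [NNRealRMK.lintegral_rieszMeasure, ENNReal.ofReal, ENNReal.coe_le_coe, ← NNReal.coe_le_coe,
    Real.coe_toNNReal _ (norm_nonneg F)]
  refine ciSup_le fun ⟨g, hg⟩ => ?_
  have := apply_le_of_forall_norm_le F zero_le_one (g := g) fun x => (hg x).trans ?_
  · simpa using this
  · have h2 : (u' x : ℝ) = u x := by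
      simp only [u', CompactlySupportedContinuousMap.nnrealPart_apply]
      exact Real.coe_toNNReal _ (hu x).1
    rw [h2]
    exact (hu x).2

variable {F} in
/-- A bound of a functional by an integral extends from functions with compact support to functions
vanishing at infinity, by cutting off. -/
lemma apply_le_integral_norm [SecondCountableTopology E] {ν : Measure X} [IsFiniteMeasure ν]
    (h : ∀ g : C₀(X, E), HasCompactSupport g → F g ≤ ∫ x, ‖g x‖ ∂ν) (g : C₀(X, E)) :
    F g ≤ ∫ x, ‖g x‖ ∂ν := by
  have hint : Integrable (fun x => ‖g x‖) ν :=
    (Integrable.of_bound (g.stronglyMeasurable fun K hK => hK.measurableSet).aestronglyMeasurable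
      ‖g‖ (Eventually.of_forall g.norm_apply_le)).norm
  refine le_of_forall_pos_le_add fun ε hε => ?_
  obtain ⟨δ, hδ, hδε⟩ : ∃ δ : ℝ, 0 < δ ∧ ‖F‖ * δ ≤ ε := by
    refine ⟨ε / (‖F‖ + 1), by positivity, ?_⟩
    rw [← mul_div_assoc, div_le_iff₀ (by positivity)]
    nlinarith [norm_nonneg F]
  have hK : IsCompact (g ⁻¹' {a | δ ≤ ‖a‖}) :=
    g.isCompact_preimage (isClosed_le continuous_const continuous_norm) (by simpa using hδ)
  obtain ⟨u, hu1, -, huc, hu⟩ := exists_continuous_one_zero_of_isCompact hK isClosed_empty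
    (disjoint_empty _)
  have hle (x : X) : ‖u x • g x‖ ≤ ‖g x‖ := by
    rw [norm_smul, Real.norm_of_nonneg (hu x).1]
    exact mul_le_of_le_one_left (norm_nonneg _) (hu x).2
  let g' : C₀(X, E) := ofNormLe _ (u.continuous.smul g.continuous) g hle
  have h1 : F g' ≤ ∫ x, ‖g x‖ ∂ν :=
    (h g' (huc.smul_right (f' := g))).trans (integral_mono_of_nonneg
      (Eventually.of_forall fun x => norm_nonneg _) hint (Eventually.of_forall hle))
  have h3 : F (g - g') ≤ ‖F‖ * δ := by
    refine apply_le_of_forall_norm_le F hδ.le fun x => ?_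
    have h4 : (g - g') x = (1 - u x) • g x := by
      simp only [sub_smul, one_smul]
      rfl
    rw [h4, norm_smul, Real.norm_of_nonneg (sub_nonneg.2 (hu x).2)]
    by_cases hx : δ ≤ ‖g x‖
    · have : u x = 1 := hu1 hx
      simp [this, hδ.le]
    · refine (mul_le_of_le_one_left (norm_nonneg _) ?_).trans (not_le.1 hx).le
      linarith [(hu x).1]
  have h6 : F g = F g' + F (g - g') := by rw [← map_add, add_sub_cancel]
  linarith

lemma exists_regular_measure_apply_le [SecondCountableTopology E] :
    ∃ ν : Measure X, IsFiniteMeasure ν ∧ ν.Regular ∧ ∀ g : C₀(X, E), F g ≤ ∫ x, ‖g x‖ ∂ν := by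
  refine ⟨NNRealRMK.rieszMeasure (dualVariationLinear F), inferInstance, inferInstance,
    apply_le_integral_norm fun g hg => ?_⟩
  let n : C_c(X, ℝ≥0) := ⟨⟨fun x => ‖g x‖₊, g.continuous.nnnorm⟩, hg.comp_left nnnorm_zero⟩
  have h2 : F g ≤ dualVariationLinear F n := le_dualVariation (f := n) fun x => le_rfl
  rw [← NNRealRMK.integral_rieszMeasure] at h2
  exact h2

omit [LocallyCompactSpace X] in
lemma exists_isCompact_isOpen_measure_sdiff_le (ν : Measure X) [IsFiniteMeasure ν] [ν.Regular]
    {S : Set X} (hS : MeasurableSet S) {ε : ℝ≥0∞} (hε : ε ≠ 0) :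
    ∃ K G : Set X, IsCompact K ∧ IsOpen G ∧ K ⊆ S ∧ S ⊆ G ∧ ν (G \ K) ≤ ε := by
  obtain ⟨K, hKS, hKc, hK'⟩ := hS.exists_isCompact_sdiff_lt (measure_ne_top ν S)
    (ENNReal.half_pos hε).ne'
  obtain ⟨G, hSG, hG, -, hG'⟩ := hS.exists_isOpen_sdiff_lt (measure_ne_top ν S)
    (ENNReal.half_pos hε).ne'
  refine ⟨K, G, hKc, hG, hKS, hSG, ?_⟩
  have : G \ K ⊆ (G \ S) ∪ (S \ K) := fun x hx => by
    by_cases hxS : x ∈ S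
    · exact Or.inr ⟨hxS, hx.2⟩
    · exact Or.inl ⟨hx.1, hxS⟩
  calc ν (G \ K) ≤ ν (G \ S) + ν (S \ K) := (measure_mono this).trans (measure_union_le _ _)
    _ ≤ ε / 2 + ε / 2 := add_le_add hG'.le hK'.le
    _ = ε := ENNReal.add_halves ε

end Borel

/-- A bounded functional on `C₀(X, E)` is dominated by integration of the norm against a finite
regular measure. On a σ-algebra between the one generated by the compact sets and the Borel one,
this measure is the restriction of the Riesz measure of the total variation. -/
theorem exists_measure_abs_apply_le [mX : MeasurableSpace X] (hle : mX ≤ borel X)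
    (hK : ∀ K : Set X, IsCompact K → MeasurableSet K) [SecondCountableTopology E] :
    ∃ ν : Measure X, IsFiniteMeasure ν ∧
      (∀ S, MeasurableSet S → ∀ ε : ℝ≥0∞, ε ≠ 0 → ∃ K G : Set X, IsCompact K ∧ IsOpen G ∧ K ⊆ S ∧
        S ⊆ G ∧ ∀ T, MeasurableSet T → T ⊆ G \ K → ν T ≤ ε) ∧
      ∀ g : C₀(X, E), |F g| ≤ ∫ x, ‖g x‖ ∂ν := by
  have hb : @BorelSpace X _ (borel X) := @BorelSpace.mk X _ (borel X) rfl
  obtain ⟨ν, hν, hreg, hF⟩ := exists_regular_measure_apply_le (bX := borel X) F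
  refine ⟨ν.trim hle, isFiniteMeasure_trim hle, fun S hS ε hε => ?_, fun g => ?_⟩
  · obtain ⟨K, G, hKc, hG, hKS, hSG, h⟩ :=
      exists_isCompact_isOpen_measure_sdiff_le (bX := borel X) ν (hle S hS) hε
    refine ⟨K, G, hKc, hG, hKS, hSG, fun T hT hTGK => ?_⟩
    rw [trim_measurableSet_eq hle hT]
    exact (measure_mono hTGK).trans h
  · rw [← integral_trim (μ := ν) hle (g.stronglyMeasurable hK).norm, abs_le]
    have h1 := hF g
    have h2 := hF (-g)
    simp only [map_neg, neg_apply, norm_neg] at h2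
    exact ⟨by linarith, h1⟩

end ZeroAtInftyContinuousMap

end DualVariation

/-! ### The Riesz representation theorem for algebra-valued functions -/

section Representation

/-- The Riesz representation theorem for a functional that is bounded with respect to a seminorm
induced by a linear map into a Hilbert space. -/
lemma exists_inner_eq_of_abs_le {W K : Type*} [AddCommGroup W] [Module ℝ W]
    [NormedAddCommGroup K] [InnerProductSpace ℝ K] [CompleteSpace K] (j : W →ₗ[ℝ] K)
    (F : W →ₗ[ℝ] ℝ) (C : ℝ) (h : ∀ w, |F w| ≤ C * ‖j w‖) : ∃ u : K, ∀ w, F w = inner ℝ u (j w) := by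
  have hF : F ∈ LinearMap.range j.dualMap := by
    rw [LinearMap.range_dualMap_eq_dualAnnihilator_ker, Submodule.mem_dualAnnihilator]
    intro w hw
    have := h w
    rw [LinearMap.mem_ker.1 hw, norm_zero, mul_zero] at this
    exact abs_nonpos_iff.1 this
  -- The functional `φ` is bounded on the range of `j` only, whence the extension `ψ`.
  obtain ⟨φ, rfl⟩ := hF
  obtain ⟨ψ, hψ, -⟩ := exists_extension_norm_eq (LinearMap.range j)
    ((φ.comp (LinearMap.range j).subtype).mkContinuous C (by rintro ⟨_, w, rfl⟩; exact h w))
  refine ⟨(InnerProductSpace.toDual ℝ K).symm ψ, fun w => ?_⟩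
  rw [InnerProductSpace.toDual_symm_apply, hψ ⟨j w, w, rfl⟩]
  rfl

namespace MeasureTheory

variable {X E F G : Type*} [MeasurableSpace X] [NormedAddCommGroup E] [NormedSpace ℝ E]
  [NormedAddCommGroup F] [NormedSpace ℝ F] [NormedAddCommGroup G] [NormedSpace ℝ G]
  {ν : Measure X} {h : X → F}

lemma isFiniteMeasure_variation_withDensityᵥ [CompleteSpace F] (hh : Integrable h ν) :
    IsFiniteMeasure (ν.withDensityᵥ h).variation := by
  rw [Measure.variation_withDensityᵥ hh]
  exact isFiniteMeasure_withDensity hh.2.ne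

lemma integrable_bilin_of_bound (hh : Integrable h ν) (B : E →L[ℝ] F →L[ℝ] G) {f : X → E}
    (hf : StronglyMeasurable f) {C : ℝ} (hC : ∀ x, ‖f x‖ ≤ C) :
    Integrable (fun x => B (f x) (h x)) ν := by
  refine Integrable.mono' (hh.norm.const_mul (‖B‖ * C)) ?_ (Eventually.of_forall fun x => ?_)
  · exact B.aestronglyMeasurable_comp₂ hf.aestronglyMeasurable hh.aestronglyMeasurable
  · exact (B.le_opNorm₂ _ _).trans (by gcongr; exact hC x)

lemma integral_withDensityᵥ_simpleFunc [CompleteSpace F] [CompleteSpace G]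
    (hh : Integrable h ν) (B : E →L[ℝ] F →L[ℝ] G)
    (f : SimpleFunc X E) :
    (ν.withDensityᵥ h).integral f B = ∫ x, B (f x) (h x) ∂ν := by
  have := isFiniteMeasure_variation_withDensityᵥ hh
  induction f using SimpleFunc.induction with
  | const c hs =>
    rename_i s
    have h1 : ⇑(SimpleFunc.piecewise s hs (SimpleFunc.const X c) (SimpleFunc.const X 0)) =
        s.indicator fun _ => c := by
      ext x
      by_cases hx : x ∈ s <;> simp [hx]
    rw [h1, VectorMeasure.integral_indicator_const c hs, withDensityᵥ_apply hh hs,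
      ← (B c).integral_comp_comm hh.integrableOn, ← integral_indicator hs]
    congr 1
    ext x
    by_cases hx : x ∈ s <;> simp [hx]
  | add _ hf hg =>
    rename_i f g _
    have hb (f : SimpleFunc X E) : Integrable (fun x => B (f x) (h x)) ν := by
      obtain ⟨C, hC⟩ := f.exists_forall_norm_le
      exact integrable_bilin_of_bound hh B f.stronglyMeasurable hC
    rw [SimpleFunc.coe_add, VectorMeasure.integral_add, hf, hg, ← integral_add (hb f) (hb g)]
    · simp
    · exact SimpleFunc.integrable_of_isFiniteMeasure f
    · exact SimpleFunc.integrable_of_isFiniteMeasure g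

lemma integral_withDensityᵥ [CompleteSpace F] [CompleteSpace G] (hh : Integrable h ν)
    (B : E →L[ℝ] F →L[ℝ] G) {f : X → E}
    (hf : StronglyMeasurable f) {C : ℝ} (hC : ∀ x, ‖f x‖ ≤ C) :
    (ν.withDensityᵥ h).integral f B = ∫ x, B (f x) (h x) ∂ν := by
  have := isFiniteMeasure_variation_withDensityᵥ hh
  rcases isEmpty_or_nonempty X with hX | ⟨⟨x₀⟩⟩
  · rw [VectorMeasure.integral_of_isEmpty, integral_of_isEmpty]
  have hC0 : 0 ≤ C := (norm_nonneg _).trans (hC x₀)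
  have hlim (x : X) : Tendsto (fun n => hf.approxBounded C n x) atTop (𝓝 (f x)) :=
    hf.tendsto_approxBounded_of_norm_le (hC x)
  have hbd (n : ℕ) (x : X) : ‖hf.approxBounded C n x‖ ≤ C := hf.norm_approxBounded_le hC0 n x
  refine tendsto_nhds_unique (VectorMeasure.tendsto_integral_filter_of_norm_le_const (l := atTop)
    (Eventually.of_forall fun n => (hf.approxBounded C n).aestronglyMeasurable)
    ⟨C, Eventually.of_forall fun n => Eventually.of_forall (hbd n)⟩
    (Eventually.of_forall hlim)) ?_
  simp only [integral_withDensityᵥ_simpleFunc hh]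
  refine tendsto_integral_of_dominated_convergence (fun x => ‖B‖ * C * ‖h x‖)
    (fun n => (integrable_bilin_of_bound hh B
      (hf.approxBounded C n).stronglyMeasurable (hbd n)).aestronglyMeasurable)
    (hh.norm.const_mul _) (fun n => Eventually.of_forall fun x => ?_)
    (Eventually.of_forall fun x => ?_)
  · exact (B.le_opNorm₂ _ _).trans (by gcongr; exact hbd n x)
  · exact (((B.flip (h x)).continuous.tendsto _).comp (hlim x))

end MeasureTheory

/-- On finite measure spaces, `L²` functions are integrable and the `L¹` norm is bounded by the `L²`
norm. -/
lemma integral_norm_le_mul_norm_toLp {X V : Type*} [NormedAddCommGroup V] [MeasurableSpace X]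
    {ν : Measure X} [IsFiniteMeasure ν]
    {f : X → V} (hf : MemLp f 2 ν) :
    ∫ x, ‖f x‖ ∂ν ≤ (ν univ ^ (1 / 2 : ℝ)).toReal * ‖hf.toLp f‖ := by
  have h := eLpNorm_le_eLpNorm_mul_rpow_measure_univ (p := 1) (q := 2) (μ := ν)
    (by norm_num) hf.aestronglyMeasurable
  rw [Lp.norm_toLp, ← ENNReal.toReal_mul, integral_norm_eq_lintegral_enorm hf.aestronglyMeasurable,
    ← eLpNorm_one_eq_lintegral_enorm, mul_comm]
  refine ENNReal.toReal_mono ?_ (h.trans_eq ?_)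
  · refine ENNReal.mul_ne_top hf.2.ne (ENNReal.rpow_ne_top_of_nonneg (by norm_num) ?_)
    exact measure_ne_top _ _
  · norm_num

variable {X A V : Type*} [TopologicalSpace X] [T2Space X] [LocallyCompactSpace X]
  [CStarAlgebra A] [FiniteDimensional ℝ A] [NormedAddCommGroup V] [InnerProductSpace ℝ V]

lemma secondCountableTopology_of_finiteDimensional : SecondCountableTopology A :=
  have := FiniteDimensional.proper_real A
  inferInstance

/-- The Riesz representation theorem for `C₀(X, A)`. With respect to a dominating measure `ν`, the
functional is bounded in `L²(ν)`, hence given by a density `h ∈ L²(ν)`, and `μ` is the vector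
measure with density `h`. -/
theorem exists_regularVectorMeasure_apply_eq [mX : MeasurableSpace X] (hle : mX ≤ borel X)
    (hK : ∀ K : Set X, IsCompact K → MeasurableSet K) (e : A ≃L[ℝ] V) (τ : A →L[ℝ] ℝ)
    (hτ : ∀ a b, inner ℝ (e a) (e b) = τ (star a * b)) (F : StrongDual ℝ C₀(X, A)) :
    ∃ μ : RegularVectorMeasure X A, ∀ f, F f = τ (μ.integral fun x => star (f x)) := by
  have := secondCountableTopology_of_finiteDimensional (A := A)
  have : FiniteDimensional ℝ V := e.toLinearEquiv.finiteDimensional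
  have : CompleteSpace V := FiniteDimensional.complete ℝ V
  obtain ⟨ν, hν, hreg, hF⟩ := ZeroAtInftyContinuousMap.exists_measure_abs_apply_le F hle hK
  have hmem (f : C₀(X, A)) : MemLp (fun x => e (f x)) 2 ν :=
    MemLp.of_bound (e.continuous.comp_stronglyMeasurable
      (f.stronglyMeasurable hK)).aestronglyMeasurable (‖(e : A →L[ℝ] V)‖ * ‖f‖)
      (Eventually.of_forall fun x => ((e : A →L[ℝ] V).le_opNorm _).trans
        (mul_le_mul_of_nonneg_left (f.norm_apply_le x) (norm_nonneg _)))
  let j : C₀(X, A) →ₗ[ℝ] Lp V 2 ν :=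
    { toFun f := (hmem f).toLp
      map_add' f g := by
        rw [← MemLp.toLp_add]
        congr 1
        ext x
        simp
      map_smul' c f := by
        rw [RingHom.id_apply, ← MemLp.toLp_const_smul]
        congr 1
        ext x
        simp }
  have hj (f : C₀(X, A)) : |F f| ≤
      (‖(e.symm : V →L[ℝ] A)‖ * (ν univ ^ (1 / 2 : ℝ)).toReal) * ‖j f‖ := by
    refine (hF f).trans ?_
    rw [mul_assoc]
    refine le_trans ?_ (mul_le_mul_of_nonneg_left (integral_norm_le_mul_norm_toLp (hmem f))
      (norm_nonneg _))
    rw [← integral_const_mul]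
    refine integral_mono_of_nonneg (Eventually.of_forall fun x => norm_nonneg _)
      (((hmem f).integrable (by norm_num)).norm.const_mul _) (Eventually.of_forall fun x => ?_)
    simpa using (e.symm : V →L[ℝ] A).le_opNorm (e (f x))
  obtain ⟨H, hH⟩ := exists_inner_eq_of_abs_le j F.toLinearMap _ hj
  set h : X → A := fun x => e.symm (H x)
  have hh : Integrable h ν :=
    (e.symm : V →L[ℝ] A).integrable_comp ((Lp.memLp H).integrable (by norm_num))
  refine ⟨⟨ν.withDensityᵥ h, ?_, fun S hS ε hε => ?_⟩, fun f => ?_⟩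
  · have := isFiniteMeasure_variation_withDensityᵥ hh
    exact measure_lt_top _ _
  · obtain ⟨δ, hδ, hδ'⟩ := exists_pos_setLIntegral_lt_of_measure_lt hh.2.ne
      (ENNReal.ofReal_pos.2 hε).ne'
    obtain ⟨δ', hδ0, hδ1⟩ := exists_between hδ
    obtain ⟨K, G, hKc, hG, hKS, hSG, hT⟩ := hreg S hS δ' hδ0.ne'
    refine ⟨K, G, hKc, hG, hKS, hSG, fun T hTm hTGK => ?_⟩
    rw [withDensityᵥ_apply hh hTm]
    have h1 : ‖∫ x in T, h x ∂ν‖ₑ ≤ ENNReal.ofReal ε :=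
      (enorm_integral_le_lintegral_enorm _).trans (hδ' T ((hT T hTm hTGK).trans_lt hδ1)).le
    rwa [← ofReal_norm, ENNReal.ofReal_le_ofReal_iff hε.le] at h1
  · have hs : StronglyMeasurable fun x => star (f x) :=
      continuous_star.comp_stronglyMeasurable (f.stronglyMeasurable hK)
    have hb (x : X) : ‖star (f x)‖ ≤ ‖f‖ := by
      rw [norm_star]
      exact f.norm_apply_le x
    change F f = τ ((ν.withDensityᵥ h).integral (fun x => star (f x)) (ContinuousLinearMap.mul ℝ A))
    rw [integral_withDensityᵥ hh _ hs hb,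
      ← τ.integral_comp_comm (integrable_bilin_of_bound hh _ hs hb)]
    refine (hH f).trans ?_
    rw [L2.inner_def]
    refine integral_congr_ae ?_
    filter_upwards [(hmem f).coeFn_toLp] with x hx
    rw [ContinuousLinearMap.mul_apply', ← hτ, real_inner_comm]
    simp only [j, h, LinearMap.coe_mk, AddHom.coe_mk, e.apply_symm_apply]
    rw [hx]

end Representation

/-! ### The pairing of functions and measures -/

section AdjointIntegral

variable {X A : Type*} [TopologicalSpace X] [MeasurableSpace X] [CStarAlgebra A]

namespace RegularVectorMeasure

/-- The pairing `∫ f(x)⋆ dμ(x)` of functions vanishing at infinity with regular vector measures.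
It is conjugate linear over `A` in `f`. -/
noncomputable def adjIntegral (μ : RegularVectorMeasure X A) (f : C₀(X, A)) : A :=
  μ.integral fun x => star (f x)

variable [FiniteDimensional ℝ A] (hK : ∀ K : Set X, IsCompact K → MeasurableSet K)
  (μ : RegularVectorMeasure X A)

include hK

lemma integrable_star_apply (f : C₀(X, A)) : μ.1.Integrable fun x => star (f x) := by
  have := secondCountableTopology_of_finiteDimensional (A := A)
  refine Integrable.of_bound (continuous_star.comp_stronglyMeasurable
    (f.stronglyMeasurable hK)).aestronglyMeasurable ‖f‖ (Eventually.of_forall fun x => ?_)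
  rw [norm_star]
  exact f.norm_apply_le x

lemma adjIntegral_add (f g : C₀(X, A)) :
    μ.adjIntegral (f + g) = μ.adjIntegral f + μ.adjIntegral g := by
  simp only [adjIntegral, RegularVectorMeasure.integral, ZeroAtInftyContinuousMap.add_apply,
    star_add]
  exact VectorMeasure.integral_fun_add (μ.integrable_star_apply hK f)
    (μ.integrable_star_apply hK g)

lemma adjIntegral_op_smul (c : A) (f : C₀(X, A)) :
    μ.adjIntegral (MulOpposite.op c • f) = star c * μ.adjIntegral f := by
  have hf := μ.integrable_star_apply hK f
  have h1 := VectorMeasure.integral_continuousLinearMap_comp (B := ContinuousLinearMap.mul ℝ A)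
    (C := ContinuousLinearMap.mul ℝ A (star c)) hf
  have h2 := VectorMeasure.continuousLinearMap_apply_integral (B := ContinuousLinearMap.mul ℝ A)
    (C := ContinuousLinearMap.mul ℝ A (star c)) hf
  have h3 : (ContinuousLinearMap.mul ℝ A) ∘L (ContinuousLinearMap.mul ℝ A (star c)) =
      (ContinuousLinearMap.compL ℝ A A A (ContinuousLinearMap.mul ℝ A (star c))) ∘L
        ContinuousLinearMap.mul ℝ A := by
    ext a b
    simp [mul_assoc]
  rw [h3, ← h2] at h1
  simpa [adjIntegral, RegularVectorMeasure.integral] using h1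

lemma continuous_adjIntegral : Continuous μ.adjIntegral := by
  let T : C₀(X, A) →+ A := AddMonoidHom.mk' μ.adjIntegral (μ.adjIntegral_add hK)
  refine (AddMonoidHomClass.lipschitz_of_bound T
    (‖ContinuousLinearMap.mul ℝ A‖ * μ.1.variation.real univ) fun f => ?_).continuous
  refine (VectorMeasure.norm_integral_le_of_norm_le_const (C := ‖f‖)
    (Eventually.of_forall fun x => ?_)).trans_eq (by ring)
  rw [norm_star]
  exact f.norm_apply_le x

omit [FiniteDimensional ℝ A] in
lemma ext_of_adjIntegral_eq [T2Space X] [LocallyCompactSpace X] {μ ν : RegularVectorMeasure X A}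
    (h : ∀ f, μ.adjIntegral f = ν.adjIntegral f) : μ = ν := by
  refine ext_of_integral_eq hK fun g => ?_
  let f : C₀(X, A) :=
    { toFun x := g x • 1
      continuous_toFun := g.continuous.smul continuous_const
      zero_at_infty' := by simpa using g.zero_at_infty'.smul_const (1 : A) }
  have hf (x : X) : star (f x) = g x • 1 := by
    change star (g x • (1 : A)) = _
    simp
  simpa only [adjIntegral, hf] using h f

end RegularVectorMeasure

end AdjointIntegral

/-! ### The Hilbert module as a real Hilbert space -/

section Module

lemma apply_star_eq_of_inner_eq {A V : Type*} [CStarAlgebra A] [NormedAddCommGroup V]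
    [InnerProductSpace ℝ V] {e : A ≃L[ℝ] V} {τ : A →L[ℝ] ℝ}
    (hτ : ∀ a b, inner ℝ (e a) (e b) = τ (star a * b)) (a : A) :
    τ (star a) = τ a := by
  have h1 := hτ a 1
  have h2 := hτ 1 a
  rw [real_inner_comm, h2] at h1
  simpa using h1.symm

namespace PDKernel

variable {X A : Type*} [CStarAlgebra A] {k : PDKernel X A}

namespace RKHM

open UniformSpace

lemma inner_add_right (u v w : k.RKHM) : inner A u (v + w) = inner A u v + inner A u w := by
  induction u, v, w using Completion.induction_on₃ with
  | hp =>
    refine isClosed_eq ?_ (Continuous.add ?_ ?_)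
    · exact continuous_inner.comp (by fun_prop :
        Continuous fun p : k.RKHM × k.RKHM × k.RKHM => (p.1, p.2.1 + p.2.2))
    · exact continuous_inner.comp (by fun_prop :
        Continuous fun p : k.RKHM × k.RKHM × k.RKHM => (p.1, p.2.1))
    · exact continuous_inner.comp (by fun_prop :
        Continuous fun p : k.RKHM × k.RKHM × k.RKHM => (p.1, p.2.2))
  | ih u v w =>
    rw [← Completion.coe_add]
    simp only [inner_coe, PreRKHM.inner_add_right]

lemma star_inner (u v : k.RKHM) : star (inner A u v) = inner A v u := by
  induction u, v using Completion.induction_on₂ with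
  | hp =>
    exact isClosed_eq (continuous_star.comp continuous_inner)
      (continuous_inner.comp continuous_swap)
  | ih u v => simp only [inner_coe, PreRKHM.star_inner]

lemma inner_smul_right (u v : k.RKHM) (a : Aᵐᵒᵖ) : inner A u (a • v) = inner A u v * a.unop := by
  induction u, v using Completion.induction_on₂ with
  | hp =>
    have h : Continuous fun p : k.RKHM × k.RKHM => (p.1, a • p.2) :=
      continuous_fst.prodMk (continuous_snd.const_smul a)
    exact isClosed_eq (continuous_inner.comp h) (continuous_inner.mul continuous_const)
  | ih u v =>
    rw [← Completion.coe_smul]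
    simp only [inner_coe, PreRKHM.inner_smul_right]

lemma inner_add_left (u v w : k.RKHM) : inner A (u + v) w = inner A u w + inner A v w := by
  rw [← star_inner, inner_add_right, star_add, star_inner, star_inner]

lemma inner_smul_left (u v : k.RKHM) (a : Aᵐᵒᵖ) :
    inner A (a • u) v = star a.unop * inner A u v := by
  rw [← star_inner, inner_smul_right, star_mul, star_inner]

lemma norm_inner_le (u v : k.RKHM) : ‖inner A u v‖ ≤ ‖u‖ * ‖v‖ := by
  induction u, v using Completion.induction_on₂ with
  | hp => exact isClosed_le continuous_inner.norm (by fun_prop)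
  | ih u v => simpa only [inner_coe, Completion.norm_coe] using PreRKHM.norm_inner_le u v

lemma continuous_eval (x : X) : Continuous fun v : k.RKHM => v.eval x :=
  continuous_inner.comp (by fun_prop : Continuous fun v : k.RKHM => (k.feature x, v))

lemma eval_smul (a : Aᵐᵒᵖ) (v : k.RKHM) (x : X) : (a • v).eval x = v.eval x * a.unop :=
  inner_smul_right _ _ _

lemma norm_eval_le (v : k.RKHM) (x : X) : ‖v.eval x‖ ≤ √‖k.toFun x x‖ * ‖v‖ := by
  refine (norm_inner_le _ _).trans_eq ?_
  rw [feature, Completion.norm_coe, PreRKHM.norm_def, PreRKHM.inner_prePhi, PreRKHM.eval_prePhi]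

end RKHM

/-- The real vector space underlying `M_k`, as a type of its own that can carry the norm of a real
inner product. -/
def RealRKHM (k : PDKernel X A) : Type _ := k.RKHM

noncomputable instance : AddCommGroup k.RealRKHM := inferInstanceAs (AddCommGroup k.RKHM)

noncomputable instance : Module ℝ k.RealRKHM :=
  inferInstanceAs (Module ℝ (RestrictScalars ℝ Aᵐᵒᵖ k.RKHM))

namespace RealRKHM

/-- The identity map. -/
noncomputable def toRKHM : k.RealRKHM ≃+ k.RKHM := AddEquiv.refl k.RKHM

lemma toRKHM_smul (r : ℝ) (v : k.RealRKHM) :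
    toRKHM (r • v) = MulOpposite.op (algebraMap ℝ A r) • toRKHM v := rfl

variable {V : Type*} [NormedAddCommGroup V] [InnerProductSpace ℝ V] (e : A ≃L[ℝ] V) (τ : A →L[ℝ] ℝ)
  (hτ : ∀ a b, inner ℝ (e a) (e b) = τ (star a * b))

include hτ

lemma apply_inner_self_nonneg (v : k.RKHM) : 0 ≤ τ (inner A v v) := by
  induction v using UniformSpace.Completion.induction_on with
  | hp =>
    have h : Continuous fun v : k.RKHM => inner A v v :=
      RKHM.continuous_inner.comp (by fun_prop : Continuous fun v : k.RKHM => (v, v))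
    exact isClosed_le continuous_const (τ.continuous.comp h)
  | ih u =>
    obtain ⟨d, hd⟩ := u.inner_self_pos
    rw [RKHM.inner_coe, hd, ← hτ]
    exact real_inner_self_nonneg

/-- The norm of `M_k` is bounded by the one of the real inner product. On functions `∑ᵢ φ(xᵢ) cᵢ`,
`⟪v, v⟫ = d⋆ d` and `τ(d⋆ d) = ‖e d‖²`. -/
lemma sq_norm_le (v : k.RKHM) :
    ‖v‖ ^ 2 ≤ ‖(e.symm : V →L[ℝ] A)‖ ^ 2 * τ (inner A v v) := by
  induction v using UniformSpace.Completion.induction_on with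
  | hp =>
    have h : Continuous fun v : k.RKHM => inner A v v :=
      RKHM.continuous_inner.comp (by fun_prop : Continuous fun v : k.RKHM => (v, v))
    exact isClosed_le (by fun_prop) (continuous_const.mul (τ.continuous.comp h))
  | ih u =>
    obtain ⟨d, hd⟩ := u.inner_self_pos
    rw [RKHM.inner_coe, UniformSpace.Completion.norm_coe, PreRKHM.norm_sq, hd,
      CStarRing.norm_star_mul_self, ← hτ, real_inner_self_eq_norm_sq, ← sq, ← mul_pow]
    have := (e.symm : V →L[ℝ] A).le_opNorm (e d)
    gcongr
    simpa using this

/-- The real inner product `τ⟪u, v⟫` on `M_k`. -/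
@[reducible] noncomputable def innerCore : InnerProductSpace.Core ℝ k.RealRKHM where
  inner u v := τ (inner A (toRKHM u) (toRKHM v))
  conj_inner_symm u v := by
    rw [← RKHM.star_inner, apply_star_eq_of_inner_eq hτ]
    rfl
  re_inner_nonneg v := apply_inner_self_nonneg e τ hτ _
  add_left u v w := by
    rw [← map_add, ← RKHM.inner_add_left, map_add]
  smul_left u v r := by
    rw [toRKHM_smul, RKHM.inner_smul_left, MulOpposite.unop_op, ← algebraMap_star_comm,
      ← Algebra.smul_def, map_smul]
    rfl
  definite v h := by
    have h1 := sq_norm_le e τ hτ (toRKHM v)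
    rw [h, mul_zero] at h1
    have h2 := norm_eq_zero.1 (pow_eq_zero_iff two_ne_zero |>.1 (le_antisymm h1 (by positivity)))
    exact (map_eq_zero_iff _ toRKHM.injective).1 h2

/-- The Riesz representation theorem for `M_k`. Since the norm of `M_k` is equivalent to the one of
the real inner product `τ⟪u, v⟫`, the latter makes `M_k` a Hilbert space, and the functional `τ ∘ T`
is represented by some `u`. Then `⟪v, u⟫ = T v`, since both sides have the same products with all
elements of `A`. -/
theorem exists_inner_eq (T : k.RKHM →+ A)
    (hT : ∀ c v, T (MulOpposite.op c • v) = star c * T v) (hTc : Continuous T) :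
    ∃ u : k.RKHM, ∀ v, inner A v u = T v := by
  let _ : NormedAddCommGroup k.RealRKHM := (innerCore (k := k) e τ hτ).toNormedAddCommGroup
  let _ : InnerProductSpace ℝ k.RealRKHM := InnerProductSpace.ofCore (innerCore e τ hτ).toCore
  have hinner (u v : k.RealRKHM) : inner ℝ u v = τ (inner A (toRKHM u) (toRKHM v)) := rfl
  have hsq (v : k.RealRKHM) : ‖v‖ ^ 2 = τ (inner A (toRKHM v) (toRKHM v)) := by
    rw [← real_inner_self_eq_norm_sq, hinner]
  have hle (v : k.RealRKHM) : ‖toRKHM v‖ ≤ ‖(e.symm : V →L[ℝ] A)‖ * ‖v‖ := by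
    refine le_of_sq_le_sq ?_ (by positivity)
    rw [mul_pow, hsq]
    exact sq_norm_le e τ hτ _
  have hge (v : k.RealRKHM) : ‖v‖ ≤ √‖τ‖ * ‖toRKHM v‖ := by
    refine le_of_sq_le_sq ?_ (by positivity)
    rw [mul_pow, hsq, Real.sq_sqrt (norm_nonneg _), sq]
    refine (le_abs_self _).trans ((τ.le_opNorm _).trans ?_)
    gcongr
    exact RKHM.norm_inner_le _ _
  have hc : UniformContinuous (toRKHM : k.RealRKHM ≃+ k.RKHM) :=
    (AddMonoidHomClass.lipschitz_of_bound toRKHM _ hle).uniformContinuous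
  have hc' : UniformContinuous (toRKHM : k.RealRKHM ≃+ k.RKHM).symm :=
    (AddMonoidHomClass.lipschitz_of_bound toRKHM.symm _
      fun v => hge (toRKHM.symm v)).uniformContinuous
  have : CompleteSpace k.RealRKHM :=
    (UniformEquiv.completeSpace_iff (⟨toRKHM.toEquiv, hc, hc'⟩ : k.RealRKHM ≃ᵤ k.RKHM)).2
      inferInstance
  let F : StrongDual ℝ k.RealRKHM :=
    { toFun v := τ (T (toRKHM v))
      map_add' u v := by simp only [map_add]
      map_smul' r v := by
        rw [toRKHM_smul, hT, ← algebraMap_star_comm, ← Algebra.smul_def, map_smul]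
        rfl
      cont := τ.continuous.comp (hTc.comp hc.continuous) }
  set u := (InnerProductSpace.toDual ℝ k.RealRKHM).symm F
  have hu (v : k.RKHM) : τ (inner A v (toRKHM u)) = τ (T v) := by
    have h : inner ℝ u (toRKHM.symm v) = F (toRKHM.symm v) :=
      InnerProductSpace.toDual_symm_apply
    rw [real_inner_comm] at h
    exact h
  refine ⟨toRKHM u, fun v => ?_⟩
  have h (c : A) : inner ℝ (e c) (e (inner A v (toRKHM u) - T v)) = 0 := by
    have := hu (MulOpposite.op c • v)
    rw [RKHM.inner_smul_left, hT] at this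
    rw [hτ, mul_sub, map_sub, sub_eq_zero]
    exact this
  have h0 := inner_self_eq_zero.1 (h _)
  exact sub_eq_zero.1 ((map_eq_zero_iff e e.injective).1 h0)

end RealRKHM

end PDKernel

end Module

/-! ### Elements of the module as functions vanishing at infinity -/

section Embedding

namespace PDKernel

variable {X A : Type*} [TopologicalSpace X] [CStarAlgebra A] {k : PDKernel X A}

lemma PreRKHM.exists_coe_eq_eval (hk : k.IsC0) (u : k.PreRKHM) :
    ∃ f : C₀(X, A), ∀ x, f x = u.eval x := by
  choose φ hφ using hk.2
  refine ⟨∑ y ∈ u.rep.support, u.rep y • φ y, fun x => ?_⟩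
  have h (s : Finset X) : (∑ y ∈ s, u.rep y • φ y) x = ∑ y ∈ s, u.rep y • φ y x := by
    classical
    induction s using Finset.induction_on with
    | empty => rfl
    | insert a s ha ih =>
      rw [Finset.sum_insert ha, Finset.sum_insert ha, ← ih]
      rfl
  rw [h, PreRKHM.eval_eq_sum]
  refine Finset.sum_congr rfl fun y _ => ?_
  rw [congrFun (hφ y) x]
  rfl

/-- The elements of `M_k` are functions vanishing at infinity: this holds on a dense submodule, and
the supremum norm is bounded by the norm of `M_k`. -/
lemma RKHM.exists_toZeroAtInfty (hk : k.IsC0) :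
    ∃ ι : k.RKHM →+ C₀(X, A), Continuous ι ∧ ∀ v x, ι v x = v.eval x := by
  choose f hf using PreRKHM.exists_coe_eq_eval hk
  obtain ⟨C, hC⟩ := hk.1
  let g : k.PreRKHM →+ C₀(X, A) := AddMonoidHom.mk' f fun u v => by
    ext x
    rw [ZeroAtInftyContinuousMap.add_apply, hf, hf, hf, PreRKHM.eval_add]
  have hg : Continuous g := by
    refine (AddMonoidHomClass.lipschitz_of_bound g (√C) fun u => ?_).continuous
    refine ZeroAtInftyContinuousMap.norm_le_of_forall (by positivity) fun x => ?_
    have h := RKHM.norm_eval_le (u : k.RKHM) x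
    rw [RKHM.eval_coe, UniformSpace.Completion.norm_coe] at h
    change ‖f u x‖ ≤ _
    rw [hf]
    exact h.trans (mul_le_mul_of_nonneg_right (Real.sqrt_le_sqrt (hC x x)) (norm_nonneg _))
  refine ⟨g.extension hg, AddMonoidHom.continuous_extension g hg, fun v x => ?_⟩
  induction v using UniformSpace.Completion.induction_on with
  | hp =>
    refine isClosed_eq ?_ (RKHM.continuous_eval x)
    have : Continuous fun f : C₀(X, A) => f x :=
      (continuous_eval_const (F := BoundedContinuousFunction X A) x).comp
        ZeroAtInftyContinuousMap.isometry_toBCF.continuous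
    exact this.comp (AddMonoidHom.continuous_extension g hg)
  | ih u =>
    rw [AddMonoidHom.extension_coe, RKHM.eval_coe]
    exact hf u x

end PDKernel

end Embedding

/-! ### Injectivity and density -/

section Universality

/-- A subspace that is not dense is annihilated by a nonzero functional. -/
lemma Submodule.exists_strongDual_of_not_dense {E : Type*} [NormedAddCommGroup E] [NormedSpace ℝ E]
    (p : Submodule ℝ E) (hp : ¬ Dense (p : Set E)) :
    ∃ F : StrongDual ℝ E, F ≠ 0 ∧ ∀ v ∈ p, F v = 0 := by
  obtain ⟨x, hx⟩ := not_forall.1 hp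
  obtain ⟨F, u, hF, hu⟩ := geometric_hahn_banach_closed_point p.topologicalClosure.convex
    p.isClosed_topologicalClosure hx
  have h0 : 0 < u := by simpa using hF 0 (zero_mem _)
  refine ⟨F, fun h => by simp [h] at hu; linarith, fun v hv => ?_⟩
  by_contra hv0
  have := hF ((u / F v) • v) (p.le_topologicalClosure (p.smul_mem _ hv))
  rw [map_smul, smul_eq_mul, div_mul_cancel₀ _ hv0] at this
  exact lt_irrefl _ this

namespace PDKernel

variable {X A V : Type*} [TopologicalSpace X] [T2Space X] [LocallyCompactSpace X]
  [CStarAlgebra A] [FiniteDimensional ℝ A] [NormedAddCommGroup V] [InnerProductSpace ℝ V]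

/-- `Φ(μ)` is the element of `M_k` that represents the functional `v ↦ T_μ(ι v)`. -/
theorem exists_embedding_injective_iff_denseRange [mX : MeasurableSpace X] (hle : mX ≤ borel X)
    (hK : ∀ K : Set X, IsCompact K → MeasurableSet K) (e : A ≃L[ℝ] V) (τ : A →L[ℝ] ℝ)
    (hτ : ∀ a b, inner ℝ (e a) (e b) = τ (star a * b)) (k : PDKernel X A) (hk : k.IsC0) :
    ∃ (ι : k.RKHM → C₀(X, A)) (Φ : RegularVectorMeasure X A → k.RKHM),
      (∀ v x, ι v x = v.eval x) ∧ (∀ μ y, (Φ μ).eval y = k.meanFun μ y) ∧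
      (Function.Injective Φ ↔ DenseRange ι) := by
  obtain ⟨ι, hιc, hι⟩ := RKHM.exists_toZeroAtInfty hk
  have hιs (c : A) (v : k.RKHM) : ι (MulOpposite.op c • v) = MulOpposite.op c • ι v := by
    ext x
    rw [hι, RKHM.eval_smul, ZeroAtInftyContinuousMap.smul_apply, hι]
    rfl
  have hT (μ : RegularVectorMeasure X A) :
      ∃ u : k.RKHM, ∀ v, inner A v u = μ.adjIntegral (ι v) :=
    RealRKHM.exists_inner_eq e τ hτ
      (AddMonoidHom.mk' (fun v => μ.adjIntegral (ι v))
        fun u v => by rw [map_add, μ.adjIntegral_add hK])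
      (fun c v => by
        change μ.adjIntegral (ι _) = _ * μ.adjIntegral (ι v)
        rw [hιs, μ.adjIntegral_op_smul hK])
      ((μ.continuous_adjIntegral hK).comp hιc)
  choose Φ hΦ using hT
  have hΦe (μ : RegularVectorMeasure X A) (y : X) :
      (Φ μ).eval y = μ.adjIntegral (ι (k.feature y)) := hΦ μ _
  refine ⟨ι, Φ, hι, fun μ y => ?_, fun hinj => ?_, fun hdense μ ν h => ?_⟩
  · rw [hΦe, RegularVectorMeasure.adjIntegral, meanFun]
    congr 1
    ext x
    rw [hι, feature, RKHM.eval_coe, PreRKHM.eval_prePhi, ← k.star_symm, phi]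
  · by_contra hdense
    let p : Submodule ℝ C₀(X, A) :=
      { ι.range with
        smul_mem' := by
          rintro r _ ⟨v, rfl⟩
          refine ⟨MulOpposite.op (algebraMap ℝ A r) • v, ?_⟩
          rw [hιs]
          ext x
          rw [ZeroAtInftyContinuousMap.smul_apply, ZeroAtInftyContinuousMap.smul_apply,
            Algebra.smul_def]
          exact (Algebra.commutes r (ι v x)).symm }
    obtain ⟨F, hF0, hF⟩ := p.exists_strongDual_of_not_dense hdense
    obtain ⟨μ, hμ⟩ := exists_regularVectorMeasure_apply_eq hle hK e τ hτ F
    -- The functional `0` is represented as well, by a measure `μ₀` that plays the role of `0`.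
    obtain ⟨μ₀, hμ₀⟩ := exists_regularVectorMeasure_apply_eq hle hK e τ hτ 0
    -- A measure whose functional vanishes on `M_k` is mapped to `0`, as `M_k` is a right module.
    have hzero (ν : RegularVectorMeasure X A) (G : StrongDual ℝ C₀(X, A))
        (hG : ∀ v, G (ι v) = 0) (hν : ∀ f, G f = τ (ν.adjIntegral f)) (y : X) :
        (Φ ν).eval y = 0 := by
      have h (c : A) : inner ℝ (e c) (e (ν.adjIntegral (ι (k.feature y)))) = 0 := by
        rw [hτ, ← ν.adjIntegral_op_smul hK, ← hιs, ← hν, hG]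
      rw [hΦe]
      exact (map_eq_zero_iff e e.injective).1 (inner_self_eq_zero.1 (h _))
    have h : μ = μ₀ := hinj (RKHM.eval_injective (funext fun y => by
      rw [hzero μ F (fun v => hF _ ⟨v, rfl⟩) hμ, hzero μ₀ 0 (fun v => rfl) hμ₀]))
    exact hF0 (ContinuousLinearMap.ext fun f => by rw [hμ, h, ← hμ₀])
  · refine RegularVectorMeasure.ext_of_adjIntegral_eq hK fun f => ?_
    refine congrFun (hdense.equalizer (μ.continuous_adjIntegral hK) (ν.continuous_adjIntegral hK)
      (funext fun v => ?_)) f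
    rw [Function.comp_apply, Function.comp_apply, ← hΦ, ← hΦ, h]

end PDKernel

end Universality

/-! ### The Hilbert-Schmidt inner product -/

section Matrix

variable (m : ℕ)

instance : FiniteDimensional ℂ (CStarMatrix (Fin m) (Fin m) ℂ) :=
  (CStarMatrix.ofMatrixₗ (R := ℂ)).finiteDimensional

instance : FiniteDimensional ℝ (CStarMatrix (Fin m) (Fin m) ℂ) :=
  FiniteDimensional.complexToReal _

/-- A matrix as the vector of its entries, in the Euclidean space of the Hilbert-Schmidt norm. -/
noncomputable def CStarMatrix.entriesEquiv :
    CStarMatrix (Fin m) (Fin m) ℂ ≃L[ℝ] EuclideanSpace ℂ (Fin m × Fin m) :=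
  LinearEquiv.toContinuousLinearEquiv
    { toFun M := WithLp.toLp 2 fun p => M p.1 p.2
      invFun v := CStarMatrix.ofMatrix fun i j => v (i, j)
      map_add' _ _ := rfl
      map_smul' _ _ := rfl
      left_inv _ := rfl
      right_inv _ := rfl }

/-- The Hilbert-Schmidt inner product of `a` and `b` depends on `a⋆ b` only, being the real part of
its trace. -/
lemma CStarMatrix.inner_entriesEquiv (a b : CStarMatrix (Fin m) (Fin m) ℂ) :
    inner ℝ (entriesEquiv m a) (entriesEquiv m b) =
      inner ℝ (entriesEquiv m 1) (entriesEquiv m (star a * b)) := by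
  have h (a b : CStarMatrix (Fin m) (Fin m) ℂ) :
      inner ℝ (entriesEquiv m a) (entriesEquiv m b) =
        (∑ p : Fin m × Fin m, b p.1 p.2 * star (a p.1 p.2)).re := by
    rw [PiLp.inner_apply, Complex.re_sum]
    rfl
  rw [h, h, Fintype.sum_prod_type, Fintype.sum_prod_type, Finset.sum_comm]
  congr 1
  refine Finset.sum_congr rfl fun j _ => ?_
  refine Eq.symm ((Finset.sum_eq_single j ?_ ?_).trans ?_)
  · intro i _ hij
    simp [CStarMatrix.one_apply_ne hij.symm]
  · simp
  · simp [CStarMatrix.mul_apply, CStarMatrix.star_apply, mul_comm]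

end Matrix

theorem mainTheorem5 (m : ℕ) {X : Type*} [TopologicalSpace X] [T2Space X] [LocallyCompactSpace X]
    [mX : MeasurableSpace X]
    (hX : mX = borel X ∨ mX = MeasurableSpace.generateFrom {K : Set X | IsCompact K})
    (k : PDKernel X (CStarMatrix (Fin m) (Fin m) ℂ)) (hk : k.IsC0) :
    ∃ (ι : k.RKHM → C₀(X, CStarMatrix (Fin m) (Fin m) ℂ))
      (Φ : RegularVectorMeasure X (CStarMatrix (Fin m) (Fin m) ℂ) → k.RKHM),
      (∀ v x, ι v x = v.eval x) ∧
      (∀ μ y, (Φ μ).eval y = k.meanFun μ y) ∧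
      (Function.Injective Φ ↔ DenseRange ι) := by
  have hb (K : Set X) (hK : IsCompact K) : MeasurableSet[borel X] K :=
    MeasurableSpace.measurableSet_generateFrom hK.isClosed.isOpen_compl |>.of_compl
  have hle : mX ≤ borel X := by
    rcases hX with rfl | rfl
    · exact le_rfl
    · exact MeasurableSpace.generateFrom_le hb
  have hK (K : Set X) (hK : IsCompact K) : MeasurableSet K := by
    rcases hX with rfl | rfl
    · exact hb K hK
    · exact MeasurableSpace.measurableSet_generateFrom hK
  exact PDKernel.exists_embedding_injective_iff_denseRange hle hK (CStarMatrix.entriesEquiv m)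
    ((innerSL ℝ (CStarMatrix.entriesEquiv m 1)).comp
      (CStarMatrix.entriesEquiv m).toContinuousLinearMap)
    (CStarMatrix.inner_entriesEquiv m) k hk
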